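/- Let $k$ and $m$ be fixed non-negative integers. There is a deterministic algorithm which, given non-zero univariate polynomials $f_1,\dots,f_m$ with rational coefficients, each in sparse representation (a list of terms $cX^e$ with the numerator and denominator of $c$ and the exponent $e$ written in binary), together with non-negative integers $\alpha_{ij}$ ($1\le i\le k$, $1\le j\le m$), decides whether the polynomial $$\phi=\sum_{i=1}^k\prod_{j=1}^m f_j^{\alpha_{ij}}\in\mathbb{R}[X]$$ is identically zero. Its running time, measured in bit operations, is bounded by a polynomial, depending only on $k$ and $m$, in $t$, in the total bit size of the sparse representations of the $f_j$, and in the values (not the bit sizes) of the $\alpha_{ij}$, where $t$ is any number such that every $f_j$ is $t$-sparse, i.e. has at most $t$ monomials. -/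

import Mathlib

/-! ### A deterministic programming language with bit-cost semantics

Data are binary trees whose leaves are integers.  Programs are built from elementary
instructions by composition, pairing, branching and unbounded `while` loops.  Every elementary
instruction is charged the total bit length of the datum it reads and of the datum it writes,
so that copying a datum or computing with long integers is never free. -/

namespace BitCost

/-- Data: binary trees with integer leaves. -/
inductive Val : Type
  | num (z : ℤ) : Val
  | pair (a b : Val) : Val

/-- The bit length of a datum; integers are written in binary. -/
def Val.size : Val → ℕ
  | .num z => 1 + Nat.size z.natAbs
  | .pair a b => 1 + a.size + b.size

/-- A Boolean answer: `1` for yes, `0` for no. -/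
def Val.ofBool (b : Bool) : Val := .num (if b then 1 else 0)

/-- A list as a datum: the empty list is the leaf `0`, and `pair` prepends an element. -/
def Val.ofList : List Val → Val
  | [] => .num 0
  | a :: l => .pair a (Val.ofList l)

/-- Elementary instructions. -/
inductive Prim : Type
  | id : Prim
  | const (z : ℤ) : Prim
  | fst : Prim
  | snd : Prim
  | isPair : Prim
  | add : Prim
  | sub : Prim
  | mul : Prim
  | lt : Prim

/-- The effect of an elementary instruction.  The arithmetic instructions act on a pair of
leaves; an instruction that is applied to a datum of the wrong shape yields the leaf `0`. -/
def Prim.apply : Prim → Val → Val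
  | .id, v => v
  | .const z, _ => .num z
  | .fst, .pair a _ => a
  | .snd, .pair _ b => b
  | .isPair, .pair _ _ => .num 1
  | .add, .pair (.num a) (.num b) => .num (a + b)
  | .sub, .pair (.num a) (.num b) => .num (a - b)
  | .mul, .pair (.num a) (.num b) => .num (a * b)
  | .lt, .pair (.num a) (.num b) => .num (if a < b then 1 else 0)
  | _, _ => .num 0

/-- Programs.  `comp g f` runs `f` and then `g`; `pair f g` runs `f` and `g` on the same input
and pairs the results; `cond c f g` runs `f` or `g` according to the result of `c`;
`loop c f` is `while c do f`.  The leaf `0` counts as false, every other datum as true. -/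
inductive Prog : Type
  | prim (o : Prim) : Prog
  | comp (g f : Prog) : Prog
  | pair (f g : Prog) : Prog
  | cond (c f g : Prog) : Prog
  | loop (c f : Prog) : Prog

/-- `Runs P x y T`: the program `P` halts on the input `x` with output `y` after time `T`. -/
inductive Runs : Prog → Val → Val → ℕ → Prop
  | prim (o : Prim) (x : Val) :
      Runs (.prim o) x (o.apply x) (1 + x.size + (o.apply x).size)
  | comp {g f : Prog} {x y z : Val} {T₁ T₂ : ℕ} :
      Runs f x y T₁ → Runs g y z T₂ → Runs (.comp g f) x z (1 + T₁ + T₂)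
  | pair {f g : Prog} {x y z : Val} {T₁ T₂ : ℕ} :
      Runs f x y T₁ → Runs g x z T₂ → Runs (.pair f g) x (.pair y z) (1 + T₁ + T₂)
  | cond_true {c f g : Prog} {x b y : Val} {T₁ T₂ : ℕ} :
      Runs c x b T₁ → b ≠ .num 0 → Runs f x y T₂ → Runs (.cond c f g) x y (1 + T₁ + T₂)
  | cond_false {c f g : Prog} {x y : Val} {T₁ T₂ : ℕ} :
      Runs c x (.num 0) T₁ → Runs g x y T₂ → Runs (.cond c f g) x y (1 + T₁ + T₂)
  | loop_stop {c f : Prog} {x : Val} {T : ℕ} :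
      Runs c x (.num 0) T → Runs (.loop c f) x x (1 + T)
  | loop_step {c f : Prog} {x b y z : Val} {T₁ T₂ T₃ : ℕ} :
      Runs c x b T₁ → b ≠ .num 0 → Runs f x y T₂ → Runs (.loop c f) y z T₃ →
      Runs (.loop c f) x z (1 + T₁ + T₂ + T₃)

/-- Programs are deterministic: output and running time are determined by the input. -/
theorem Runs.deterministic {P : Prog} {x y : Val} {T : ℕ} (h : Runs P x y T) :
    ∀ {y' : Val} {T' : ℕ}, Runs P x y' T' → y = y' ∧ T = T' := by
  induction h with
  | prim o x => intro y' T' h'; cases h'; exact ⟨rfl, rfl⟩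
  | comp _ _ ih₁ ih₂ =>
    intro y' T' h'
    cases h' with
    | comp h₁ h₂ =>
      obtain ⟨rfl, rfl⟩ := ih₁ h₁
      obtain ⟨rfl, rfl⟩ := ih₂ h₂
      exact ⟨rfl, rfl⟩
  | pair _ _ ih₁ ih₂ =>
    intro y' T' h'
    cases h' with
    | pair h₁ h₂ =>
      obtain ⟨rfl, rfl⟩ := ih₁ h₁
      obtain ⟨rfl, rfl⟩ := ih₂ h₂
      exact ⟨rfl, rfl⟩
  | cond_true _ hb _ ih₁ ih₂ =>
    intro y' T' h'
    cases h' with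
    | cond_true h₁ _ h₂ =>
      obtain ⟨rfl, rfl⟩ := ih₁ h₁
      obtain ⟨rfl, rfl⟩ := ih₂ h₂
      exact ⟨rfl, rfl⟩
    | cond_false h₁ _ => exact absurd (ih₁ h₁).1 hb
  | cond_false _ _ ih₁ ih₂ =>
    intro y' T' h'
    cases h' with
    | cond_true h₁ hb _ => exact absurd (ih₁ h₁).1.symm hb
    | cond_false h₁ h₂ =>
      obtain ⟨_, rfl⟩ := ih₁ h₁
      obtain ⟨rfl, rfl⟩ := ih₂ h₂
      exact ⟨rfl, rfl⟩
  | loop_stop _ ih =>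
    intro y' T' h'
    cases h' with
    | loop_stop h₁ =>
      obtain ⟨_, rfl⟩ := ih h₁
      exact ⟨rfl, rfl⟩
    | loop_step h₁ hb _ _ => exact absurd (ih h₁).1.symm hb
  | loop_step _ hb _ _ ih₁ ih₂ ih₃ =>
    intro y' T' h'
    cases h' with
    | loop_stop h₁ => exact absurd (ih₁ h₁).1 hb
    | loop_step h₁ _ h₂ h₃ =>
      obtain ⟨rfl, rfl⟩ := ih₁ h₁
      obtain ⟨rfl, rfl⟩ := ih₂ h₂
      obtain ⟨rfl, rfl⟩ := ih₃ h₃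
      exact ⟨rfl, rfl⟩

end BitCost

/-! ### Sparse representations -/

/-- A sparse representation of a univariate polynomial with rational coefficients: a list of
terms `(c, e)`, each standing for `c * X ^ e`.  The terms may come in any order, and neither
repeated exponents nor zero coefficients are excluded. -/
abbrev SparseRep : Type := List (ℚ × ℕ)

/-- The real polynomial that is represented. -/
noncomputable def SparseRep.toPoly (l : SparseRep) : Polynomial ℝ :=
  (l.map fun s => Polynomial.monomial s.2 (s.1 : ℝ)).sum

/-- The bit size of a sparse representation: numerators, denominators and exponents are all
written in binary. -/
def SparseRep.bitSize (l : SparseRep) : ℕ :=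
  (l.map fun s => 1 + Nat.size s.1.num.natAbs + Nat.size s.1.den + Nat.size s.2).sum

/-- A polynomial is `t`-sparse if it has at most `t` monomials. -/
def IsSparse (t : ℕ) (P : Polynomial ℝ) : Prop := P.support.card ≤ t

open BitCost in
/-- A sparse representation as a datum: the list of the `((numerator, denominator), exponent)`. -/
def SparseRep.encode (l : SparseRep) : Val :=
  Val.ofList (l.map fun s =>
    .pair (.pair (.num s.1.num) (.num (s.1.den : ℤ))) (.num (s.2 : ℤ)))

open BitCost in
/-- The input of the identity test: the list of the sparse representations of the `f j`,
and the matrix of exponents as the list of its rows. -/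
def encodeInput {k m : ℕ} (f : Fin m → SparseRep) (α : Fin k → Fin m → ℕ) : Val :=
  .pair (Val.ofList (List.ofFn fun j => (f j).encode))
    (Val.ofList (List.ofFn fun i => Val.ofList (List.ofFn fun j => .num (α i j : ℤ))))

/-!
The idea is that a nonzero `φ = ∑ i, ∏ j, f j ^ α i j` cannot vanish to high order at the point `1`,
so that `φ = 0` can be read off from finitely many Taylor coefficients at `1`.

*Order bound.*  Let `θ = X * d/dX`.  It does not enlarge supports, and `θ (f ^ a) * f` is a
multiple of `f ^ a` by a polynomial whose support lies in that of `f`, for every `a`.  Take a sum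
`∑ i < k + 1, P i * g i`, the `g i` being power products of the `f j`.  The Wronskian with respect
to `θ` of the sum and its summand `P 0 * g 0` is, up to the factors `g 0` and `∏ j, f j`, a sum
`∑ i < k, Q i * g i` with one summand fewer.  The supports of the new coefficients `Q i` lie in
sumsets of the old supports and one fixed set with at most `t ^ m` elements, whatever the `α i j`
are.  Either the order of the sum is at most that of `P 0 * g 0`, or the Wronskian has order exactly
one less than the sum of the two orders.  As an `s`-sparse nonzero polynomial has order less than
`s` at `1`, induction on `k` gives `rootMultiplicity_sum_prod_pow_le`, a bound on the order
that is polynomial in `t` and in `∑ α i j` for fixed `k` and `m`.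

*One evaluation decides.*  Below degree `N`, the Taylor coefficients of `φ` at `1` agree with the
coefficients of `Φ = ∑ i, ∏ j, F j ^ α i j`, where `F j` is the Taylor polynomial of `f j` at `1`,
truncated below degree `N`.  A common denominator of `Φ` and the sum of the absolute values of its
numerators are bounded by an explicit number `K` (`HeightLE`) whose bit length is polynomial.  Hence
for `c ≥ 2 * K` the single value `Φ (1 / c ^ 2)` tells whether all coefficients below degree `N`
vanish: in this case `|Φ (1 / c ^ 2)| * c ^ (2 * N) < c`, and otherwise the lowest nonzero
coefficient dominates and forces the opposite inequality (`X_pow_dvd_iff_eval_small`).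

*Bit cost.*  The value `Φ (1 / c ^ 2)` is computed exactly as an unreduced fraction of integers, the
truncated binomial series `∑ r < N, e.choose r / c ^ (2 * r)` by Horner's rule, so that exponents
written in binary cause no trouble.  `PolyTime` is closed under composition, pairing, branching
and loops whose body increases the size of the state by an amount that does not depend on the
state.  All loops here are of this kind, because bit lengths of unreduced fractions grow additively
under multiplication and addition (`PolyTime.test`).
-/

open BitCost Polynomial

/-! ### Polynomial-time functions on coded types -/

theorem Nat.polynomial_eval_mono (p : ℕ[X]) : Monotone fun x => p.eval x := by
  intro a b hab
  induction p using Polynomial.induction_on' with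
  | add p q hp hq => simpa using Nat.add_le_add hp hq
  | monomial n c => simpa using Nat.mul_le_mul_left c (Nat.pow_le_pow_left hab n)

/-- A type whose elements are written as data, together with a measure of length that bounds the bit
length of the datum.  The measure may exceed the bit length: it is the quantity in which running
times are polynomial. -/
class Coded (α : Type) where
  enc : α → Val
  meas : α → ℕ
  size_le : ∀ a, (enc a).size ≤ meas a

open Coded

theorem BitCost.Val.one_le_size (v : Val) : 1 ≤ v.size := by
  cases v <;> simp only [Val.size] <;> omega

theorem Coded.one_le_meas {α : Type} [Coded α] (a : α) : 1 ≤ meas a :=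
  (Val.one_le_size _).trans (size_le a)

/-- Integers are measured by their bit length. -/
instance : Coded ℤ where
  enc z := .num z
  meas z := (Val.num z).size
  size_le _ := le_rfl

theorem Nat.size_le_self (n : ℕ) : Nat.size n ≤ n := Nat.size_le.2 Nat.lt_two_pow_self

/-- Natural numbers are written in binary as integers, but they are measured by their value.  This
makes them usable as loop bounds. -/
instance : Coded ℕ where
  enc n := .num n
  meas n := n + 1
  size_le n := by
    have := Nat.size_le_self n
    simp only [Val.size, Int.natAbs_natCast]; omega

instance : Coded Bool where
  enc := Val.ofBool
  meas b := (Val.ofBool b).size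
  size_le _ := le_rfl

instance {α β : Type} [Coded α] [Coded β] : Coded (α × β) where
  enc x := .pair (enc x.1) (enc x.2)
  meas x := 1 + meas x.1 + meas x.2
  size_le x := by
    have := size_le x.1
    have := size_le x.2
    simp only [Val.size]; omega

instance {α : Type} [Coded α] : Coded (List α) where
  enc l := Val.ofList (l.map enc)
  meas l := 1 + (l.map fun a => 1 + meas a).sum
  size_le l := by
    induction l with
    | nil => simp [Val.ofList, Val.size]
    | cons a l ih =>
      have := size_le a
      simp only [List.map_cons, Val.ofList, Val.size, List.sum_cons]; omega

instance {α : Type} {n : ℕ} [Coded α] : Coded (Fin n → α) where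
  enc f := Val.ofList (List.ofFn fun j => enc (f j))
  meas f := 1 + ∑ j, (1 + meas (f j))
  size_le f := by
    induction n with
    | zero => simp [Val.ofList, Val.size]
    | succ n ih =>
      have := size_le (f 0)
      have := ih fun i => f i.succ
      simp only [List.ofFn_succ, Val.ofList, Val.size, Fin.sum_univ_succ]; omega

/-- `f` is computed by a program whose running time is polynomial in the measure of the input.  The
measure of the output has to be polynomially bounded too, which does not follow from the running time
and makes the notion stable under composition. -/
def PolyTime {α β : Type} [Coded α] [Coded β] (f : α → β) : Prop :=
  ∃ (P : Prog) (p : ℕ[X]), ∀ a, ∃ T,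
    Runs P (enc a) (enc (f a)) T ∧ T + meas (f a) ≤ p.eval (meas a)

namespace PolyTime

variable {α β γ : Type} [Coded α] [Coded β] [Coded γ]

theorem meas_le {f : α → β} (hf : PolyTime f) :
    ∃ p : ℕ[X], ∀ a, meas (f a) ≤ p.eval (meas a) := by
  obtain ⟨P, p, h⟩ := hf
  refine ⟨p, fun a => ?_⟩
  obtain ⟨T, -, hT⟩ := h a
  omega

theorem of_prim {f : α → β} (o : Prim) (q : ℕ[X]) (h : ∀ a, enc (f a) = o.apply (enc a))
    (hq : ∀ a, meas (f a) ≤ q.eval (meas a)) : PolyTime f := by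
  refine ⟨.prim o, 1 + X + q + q, fun a => ⟨_, h a ▸ Runs.prim o (enc a), ?_⟩⟩
  have h1 := size_le a
  have h2 := size_le (f a)
  have h3 := hq a
  simp only [eval_add, eval_one, eval_X]; omega

theorem id : PolyTime fun a : α => a :=
  of_prim .id X (fun _ => rfl) fun a => by simp

theorem comp {g : β → γ} {f : α → β} (hg : PolyTime g) (hf : PolyTime f) :
    PolyTime fun a => g (f a) := by
  obtain ⟨Pf, p, hf⟩ := hf
  obtain ⟨Pg, q, hg⟩ := hg
  refine ⟨.comp Pg Pf, 1 + p + q.comp p, fun a => ?_⟩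
  obtain ⟨T₁, r₁, h₁⟩ := hf a
  obtain ⟨T₂, r₂, h₂⟩ := hg (f a)
  refine ⟨_, .comp r₁ r₂, ?_⟩
  have := Nat.polynomial_eval_mono q (show meas (f a) ≤ p.eval (meas a) by omega)
  simp only [eval_add, eval_one, eval_comp] at *; omega

theorem pair {f : α → β} {g : α → γ} (hf : PolyTime f) (hg : PolyTime g) :
    PolyTime fun a => (f a, g a) := by
  obtain ⟨Pf, p, hf⟩ := hf
  obtain ⟨Pg, q, hg⟩ := hg
  refine ⟨.pair Pf Pg, 2 + p + q, fun a => ?_⟩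
  obtain ⟨T₁, r₁, h₁⟩ := hf a
  obtain ⟨T₂, r₂, h₂⟩ := hg a
  refine ⟨_, .pair r₁ r₂, ?_⟩
  simp only [eval_add, eval_ofNat, meas] at *; omega

theorem fst' : PolyTime fun x : α × β => x.1 :=
  of_prim .fst X (fun _ => rfl) fun a => by simp only [meas, eval_X]; omega

theorem snd' : PolyTime fun x : α × β => x.2 :=
  of_prim .snd X (fun _ => rfl) fun a => by simp only [meas, eval_X]; omega

theorem fst {f : α → β × γ} (hf : PolyTime f) : PolyTime fun a => (f a).1 := fst'.comp hf

theorem snd {f : α → β × γ} (hf : PolyTime f) : PolyTime fun a => (f a).2 := snd'.comp hf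

theorem const (b : β) : PolyTime fun _ : α => b := by
  have key : ∀ v : Val, ∃ (P : Prog) (p : ℕ[X]), ∀ x, ∃ T, Runs P x v T ∧ T ≤ p.eval x.size := by
    intro v
    induction v with
    | num z =>
      refine ⟨.prim (.const z), 1 + X + C (Val.num z).size, fun x => ⟨_, .prim _ _, ?_⟩⟩
      simp [Prim.apply]
    | pair u v hu hv =>
      obtain ⟨P, p, hP⟩ := hu
      obtain ⟨Q, q, hQ⟩ := hv
      refine ⟨.pair P Q, 1 + p + q, fun x => ?_⟩
      obtain ⟨T₁, r₁, h₁⟩ := hP x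
      obtain ⟨T₂, r₂, h₂⟩ := hQ x
      refine ⟨_, .pair r₁ r₂, ?_⟩
      simp only [eval_add, eval_one]; omega
  obtain ⟨P, p, h⟩ := key (enc b)
  refine ⟨P, p + C (meas b), fun a => ?_⟩
  obtain ⟨T, r, hT⟩ := h (enc a)
  have := Nat.polynomial_eval_mono p (size_le a)
  refine ⟨T, r, ?_⟩
  simp only [eval_add, eval_C] at *; omega

theorem cond {c : α → Bool} {f g : α → β} (hc : PolyTime c) (hf : PolyTime f)
    (hg : PolyTime g) : PolyTime fun a => if c a then f a else g a := by
  obtain ⟨Pc, pc, hc⟩ := hc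
  obtain ⟨Pf, pf, hf⟩ := hf
  obtain ⟨Pg, pg, hg⟩ := hg
  refine ⟨.cond Pc Pf Pg, 1 + pc + pf + pg, fun a => ?_⟩
  obtain ⟨T, r, hT⟩ := hc a
  simp only [eval_add, eval_one]
  cases h : c a
  · obtain ⟨T₂, r₂, h₂⟩ := hg a
    rw [h] at r
    refine ⟨_, .cond_false r r₂, ?_⟩
    simp; omega
  · obtain ⟨T₂, r₂, h₂⟩ := hf a
    rw [h] at r
    refine ⟨_, .cond_true r (by simp [enc, Val.ofBool]) r₂, ?_⟩
    simp; omega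

/-- A `while` loop is polynomial-time if the number of rounds and the measures of all intermediate
states are polynomially bounded. -/
theorem loop {c : α → Bool} {f : α → α} (hc : PolyTime c) (hf : PolyTime f) (n : α → ℕ)
    (q : ℕ[X]) (hn : ∀ a, n a ≤ q.eval (meas a))
    (hcn : ∀ a, ∀ i ≤ n a, c (f^[i] a) = decide (i < n a))
    (hq : ∀ a, ∀ i ≤ n a, meas (f^[i] a) ≤ q.eval (meas a)) :
    PolyTime fun a => f^[n a] a := by
  obtain ⟨Pc, pc, hc⟩ := hc
  obtain ⟨Pf, pf, hf⟩ := hf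
  have key : ∀ (M j : ℕ) (a : α), (∀ i < j, c (f^[i] a) = true) → c (f^[j] a) = false →
      (∀ i ≤ j, pc.eval (meas (f^[i] a)) ≤ M ∧ pf.eval (meas (f^[i] a)) ≤ M) →
      ∃ T, Runs (.loop Pc Pf) (enc a) (enc (f^[j] a)) T ∧ T ≤ (j + 1) * (1 + M + M) := by
    intro M j
    induction j with
    | zero =>
      intro a _ h0 hM
      obtain ⟨T, r, hT⟩ := hc a
      simp only [Function.iterate_zero, id_eq] at h0 hM ⊢
      rw [h0] at r
      have := hM 0 le_rfl
      simp only [Function.iterate_zero, id_eq] at this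
      exact ⟨_, Runs.loop_stop r, by omega⟩
    | succ j ih =>
      intro a h1 h0 hM
      obtain ⟨T, r, hT⟩ := hc a
      obtain ⟨T₂, r₂, h₂⟩ := hf a
      have hca := h1 0 (by omega)
      simp only [Function.iterate_zero, id_eq] at hca
      rw [hca] at r
      obtain ⟨T₃, r₃, h₃⟩ := ih (f a) (fun i hi => h1 (i + 1) (by omega)) h0
        fun i hi => hM (i + 1) (by omega)
      have := hM 0 (by omega)
      simp only [Function.iterate_zero, id_eq] at this
      refine ⟨_, .loop_step r (by simp [enc, Val.ofBool]) r₂ r₃, ?_⟩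
      rw [Nat.succ_mul (j + 1)]
      omega
  refine ⟨.loop Pc Pf, (q + 1) * (1 + (pc.comp q + pf.comp q) + (pc.comp q + pf.comp q)) + q,
    fun a => ?_⟩
  obtain ⟨T, r, hT⟩ := key (pc.eval (q.eval (meas a)) + pf.eval (q.eval (meas a))) (n a) a
    (fun i hi => by rw [hcn a i hi.le]; simpa using hi)
    (by rw [hcn a _ le_rfl]; simp) fun i hi => by
      have h1 := Nat.polynomial_eval_mono pc (hq a i hi)
      have h2 := Nat.polynomial_eval_mono pf (hq a i hi)
      simp only at h1 h2
      omega
  refine ⟨T, r, ?_⟩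
  simp only [eval_add, eval_mul, eval_one, eval_comp]
  exact Nat.add_le_add (hT.trans (Nat.mul_le_mul_right _ (Nat.succ_le_succ (hn a)))) (hq a _ le_rfl)

/-! ### Arithmetic -/

theorem size_natAbs_add (a b : ℤ) :
    Nat.size (a + b).natAbs ≤ max (Nat.size a.natAbs) (Nat.size b.natAbs) + 1 := by
  rw [Nat.size_le]
  have h1 := Nat.lt_size_self a.natAbs
  have h2 := Nat.lt_size_self b.natAbs
  have h3 := Nat.pow_le_pow_right (n := 2) (by norm_num)
    (le_max_left (Nat.size a.natAbs) (Nat.size b.natAbs))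
  have h4 := Nat.pow_le_pow_right (n := 2) (by norm_num)
    (le_max_right (Nat.size a.natAbs) (Nat.size b.natAbs))
  rw [pow_succ]
  have := Int.natAbs_add_le a b
  omega

theorem size_natAbs_mul (a b : ℤ) :
    Nat.size (a * b).natAbs ≤ Nat.size a.natAbs + Nat.size b.natAbs := by
  rw [Nat.size_le, Int.natAbs_mul, pow_add]
  exact Nat.mul_lt_mul'' (Nat.lt_size_self _) (Nat.lt_size_self _)

theorem intAdd {f g : α → ℤ} (hf : PolyTime f) (hg : PolyTime g) :
    PolyTime fun a => f a + g a := by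
  have : PolyTime fun x : ℤ × ℤ => x.1 + x.2 := of_prim .add X (fun _ => rfl) fun x => by
    have := size_natAbs_add x.1 x.2
    simp only [meas, Val.size, eval_X] at *; omega
  exact this.comp (hf.pair hg)

theorem intSub {f g : α → ℤ} (hf : PolyTime f) (hg : PolyTime g) :
    PolyTime fun a => f a - g a := by
  have : PolyTime fun x : ℤ × ℤ => x.1 - x.2 := of_prim .sub X (fun _ => rfl) fun x => by
    have := size_natAbs_add x.1 (-x.2)
    rw [Int.natAbs_neg, ← sub_eq_add_neg] at this
    simp only [meas, Val.size, eval_X] at *; omega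
  exact this.comp (hf.pair hg)

theorem intMul {f g : α → ℤ} (hf : PolyTime f) (hg : PolyTime g) :
    PolyTime fun a => f a * g a := by
  have : PolyTime fun x : ℤ × ℤ => x.1 * x.2 := of_prim .mul X (fun _ => rfl) fun x => by
    have := size_natAbs_mul x.1 x.2
    simp only [meas, Val.size, eval_X] at *; omega
  exact this.comp (hf.pair hg)

theorem intLt {f g : α → ℤ} (hf : PolyTime f) (hg : PolyTime g) :
    PolyTime fun a => decide (f a < g a) := by
  have : PolyTime fun x : ℤ × ℤ => decide (x.1 < x.2) :=
    of_prim .lt 2 (fun x => by simp [enc, Val.ofBool, Prim.apply]) fun x => by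
      by_cases h : x.1 < x.2 <;> simp [meas, Val.ofBool, Val.size, h]
  exact this.comp (hf.pair hg)

theorem natCast {f : α → ℕ} (hf : PolyTime f) : PolyTime fun a => (f a : ℤ) := by
  have : PolyTime fun n : ℕ => (n : ℤ) := of_prim .id X (fun _ => rfl) fun n => by
    rw [eval_X]
    exact size_le n
  exact this.comp hf

theorem natAdd {f g : α → ℕ} (hf : PolyTime f) (hg : PolyTime g) :
    PolyTime fun a => f a + g a := by
  have : PolyTime fun x : ℕ × ℕ => x.1 + x.2 :=
    of_prim .add X (fun x => by simp [enc, Prim.apply]) fun x => by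
      simp only [meas, eval_X]; omega
  exact this.comp (hf.pair hg)

theorem natMul {f g : α → ℕ} (hf : PolyTime f) (hg : PolyTime g) :
    PolyTime fun a => f a * g a := by
  have : PolyTime fun x : ℕ × ℕ => x.1 * x.2 :=
    of_prim .mul (X * X) (fun x => by simp [enc, Prim.apply]) fun x => by
      simp only [meas, eval_X, eval_mul]; nlinarith
  exact this.comp (hf.pair hg)

theorem natPow {f : α → ℕ} (hf : PolyTime f) (c : ℕ) : PolyTime fun a => f a ^ c := by
  induction c with
  | zero => simpa using const (α := α) (1 : ℕ)
  | succ c ih => simpa only [pow_succ] using ih.natMul hf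

/-! ### Lists and tuples -/

theorem isCons : PolyTime fun l : List α => decide (0 < l.length) :=
  of_prim .isPair 2 (fun l => by cases l <;> simp [enc, Val.ofList, Val.ofBool, Prim.apply])
    fun l => by cases l <;> simp [meas, Val.ofBool, Val.size]

theorem tail : PolyTime fun l : List α => l.tail :=
  of_prim .snd X (fun l => by cases l <;> simp [enc, Val.ofList, Prim.apply])
    fun l => by cases l <;> simp [meas]

/-- The program branches, because `fst` maps the code `0` of the empty list to `0`, which need not
encode anything. -/
theorem headD (d : α) : PolyTime fun l : List α => l.headD d := by
  obtain ⟨Pc, pc, hc⟩ := isCons (α := α)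
  obtain ⟨Pd, pd, hd⟩ := const (α := List α) d
  refine ⟨.cond Pc (.prim .fst) Pd, 1 + pc + pd + (1 + 3 * X), fun l => ?_⟩
  obtain ⟨T, r, hT⟩ := hc l
  obtain ⟨T', r', hT'⟩ := hd l
  simp only [eval_add, eval_one, eval_mul, eval_X, eval_ofNat]
  cases l with
  | nil => exact ⟨_, .cond_false r r', by
      simp only [List.headD_nil] at *; omega⟩
  | cons a l =>
    refine ⟨_, .cond_true r (by simp [enc, Val.ofBool]) (.prim _ _), ?_⟩
    have h1 := size_le (a :: l)
    have h2 := size_le a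
    have h3 : meas (a :: l) = 1 + (1 + meas a + (l.map fun a => 1 + meas a).sum) := by simp [meas]
    simp only [List.headD_cons] at *
    change 1 + T + (1 + (enc (a :: l)).size + (enc a).size) + meas a ≤ _
    omega

theorem apply {n : ℕ} (j : Fin n) : PolyTime fun f : Fin n → α => f j := by
  induction n with
  | zero => exact j.elim0
  | succ n ih =>
    cases j using Fin.cases with
    | zero =>
      refine of_prim .fst X (fun f => ?_) fun f => ?_
      · simp [enc, List.ofFn_succ, Val.ofList, Prim.apply]
      · simp only [meas, Fin.sum_univ_succ, eval_X]; omega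
    | succ j =>
      have : PolyTime fun (f : Fin (n + 1) → α) (i : Fin n) => f i.succ := by
        refine of_prim .snd X (fun f => ?_) fun f => ?_
        · simp [enc, List.ofFn_succ, Val.ofList, Prim.apply]
        · simp only [meas, Fin.sum_univ_succ, eval_X]; omega
      exact (ih j).comp this

theorem foldr_ofFn {n : ℕ} {op : β → β → β} (hop : PolyTime fun x : β × β => op x.1 x.2) (e : β)
    {g : Fin n → α → β} (hg : ∀ j, PolyTime (g j)) :
    PolyTime fun a => (List.ofFn fun j => g j a).foldr op e := by
  induction n with
  | zero => simpa using const e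
  | succ n ih =>
    simpa only [List.ofFn_succ, List.foldr_cons] using
      hop.comp ((hg 0).pair (ih fun j => hg j.succ))

/-! ### Bounded loops -/

/-- The common form of the loops below.  A counter `κ` with a number `len` of remaining rounds is
advanced by `next` and read by `cur`; the state is updated by `op` with an operand that depends
on the parameter and the counter only.  As `op` increases the measure of the state by at most `K`
times the measure of the operand, all states stay polynomially bounded. -/
theorem iterate_op {κ τ σ : Type} [Coded κ] [Coded τ] [Coded σ] {next : κ → κ}
    {cur : κ → τ} {op : σ → β → σ} {x : α → τ → β} (len : κ → ℕ)
    (hmore : PolyTime fun c => decide (0 < len c)) (hnext : PolyTime next) (hcur : PolyTime cur)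
    (hop : PolyTime fun z : σ × β => op z.1 z.2) (hx : PolyTime fun z : α × τ => x z.1 z.2)
    (hlen : ∀ c, len c ≤ meas c) (hlen_next : ∀ c, len (next c) = len c - 1)
    (hmeas_next : ∀ c, meas (next c) ≤ meas c + 1) (K : ℕ)
    (hK : ∀ s b, meas (op s b) ≤ meas s + K * meas b) :
    PolyTime fun z : κ × α × σ =>
      ((fun z : κ × α × σ => (next z.1, z.2.1, op z.2.2 (x z.2.1 (cur z.1))))^[len z.1] z).2.2 := by
  set f : κ × α × σ → κ × α × σ := fun z => (next z.1, z.2.1, op z.2.2 (x z.2.1 (cur z.1)))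
  have hf : PolyTime f :=
    (hnext.comp fst').pair (snd'.fst.pair
      (hop.comp (snd'.snd.pair (hx.comp (snd'.fst.pair (hcur.comp fst'))))))
  obtain ⟨px, hpx⟩ := hx.meas_le
  obtain ⟨pc, hpc⟩ := hcur.meas_le
  let r : ℕ[X] := C K * px.comp (1 + X + pc.comp (X + X))
  have hlen_iter : ∀ z i, len (f^[i] z).1 = len z.1 - i := by
    intro z i
    induction i with
    | zero => simp
    | succ i ih =>
      rw [Function.iterate_succ_apply']
      change len (next (f^[i] z).1) = _
      rw [hlen_next, ih]; omega
  have hbd : ∀ z i, i ≤ len z.1 → (f^[i] z).2.1 = z.2.1 ∧ meas (f^[i] z).1 ≤ meas z.1 + i ∧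
      meas (f^[i] z).2.2 ≤ meas z.2.2 + i * r.eval (meas z) := by
    intro z i
    induction i with
    | zero => simp
    | succ i ih =>
      intro hi
      obtain ⟨h1, h2, h3⟩ := ih (by omega)
      rw [Function.iterate_succ_apply']
      have hz : meas z = 1 + meas z.1 + (1 + meas z.2.1 + meas z.2.2) := rfl
      have hl := hlen z.1
      refine ⟨h1, (hmeas_next _).trans (by omega), ?_⟩
      refine (hK _ _).trans ?_
      rw [Nat.succ_mul, ← Nat.add_assoc]
      refine Nat.add_le_add h3 ?_
      simp only [r, eval_mul, eval_C, eval_comp, eval_add, eval_one, eval_X]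
      refine Nat.mul_le_mul_left _ ((hpx ((f^[i] z).2.1, cur (f^[i] z).1)).trans ?_)
      refine Nat.polynomial_eval_mono px ?_
      have h4 := hpc (f^[i] z).1
      have h5 := Nat.polynomial_eval_mono pc (show meas (f^[i] z).1 ≤ meas z + meas z by omega)
      simp only [meas, h1] at *
      omega
  refine (loop (c := fun z => decide (0 < len z.1))
    (hmore.comp (f := fun z : κ × α × σ => z.1) fst') hf (fun z => len z.1)
    (2 + X + X + X + X * r) ?_ ?_ ?_).snd.snd
  · intro z
    have := hlen z.1
    simp only [meas, eval_add, eval_X, eval_mul, eval_ofNat]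
    omega
  · intro z i hi
    simp only [hlen_iter, decide_eq_decide]
    omega
  · intro z i hi
    obtain ⟨h1, h2, h3⟩ := hbd z i hi
    have hz : meas z = 1 + meas z.1 + (1 + meas z.2.1 + meas z.2.2) := rfl
    have hl := hlen z.1
    have h4 : i * r.eval (meas z) ≤ meas z * r.eval (meas z) :=
      Nat.mul_le_mul_right _ (by omega)
    change 1 + meas (f^[i] z).1 + (1 + meas (f^[i] z).2.1 + meas (f^[i] z).2.2) ≤ _
    rw [h1]
    simp only [eval_add, eval_X, eval_mul, eval_ofNat]
    omega

theorem foldl {τ σ : Type} [Coded τ] [Coded σ] [Inhabited τ] {op : σ → β → σ} {x : α → τ → β}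
    {l : α → List τ} {e : α → σ} (hop : PolyTime fun z : σ × β => op z.1 z.2) (K : ℕ)
    (hK : ∀ s b, meas (op s b) ≤ meas s + K * meas b)
    (hx : PolyTime fun z : α × τ => x z.1 z.2) (hl : PolyTime l) (he : PolyTime e) :
    PolyTime fun a => (l a).foldl (fun s b => op s (x a b)) (e a) := by
  have h := (iterate_op (κ := List τ) List.length isCons tail (headD default) hop hx
    (fun l => by induction l <;> simp [meas] at *; omega) (fun l => by simp)
    (fun l => by cases l <;> simp [meas]; omega) K hK).comp (hl.pair (id.pair he))
  have key : ∀ a l s, ((fun z : List τ × α × σ => (z.1.tail, z.2.1,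
      op z.2.2 (x z.2.1 (z.1.headD default))))^[l.length] (l, a, s)).2.2 =
      l.foldl (fun s b => op s (x a b)) s := by
    intro a l
    induction l with
    | nil => intro s; rfl
    | cons b l ih =>
      intro s
      rw [List.length_cons, Function.iterate_succ_apply, List.foldl_cons]
      exact ih _
  simpa only [key] using h

theorem natRec {σ : Type} [Coded σ] {op : σ → β → σ} {x : α → ℕ → β}
    {n : α → ℕ} {e : α → σ} (hop : PolyTime fun z : σ × β => op z.1 z.2) (K : ℕ)
    (hK : ∀ s b, meas (op s b) ≤ meas s + K * meas b)
    (hx : PolyTime fun z : α × ℕ => x z.1 z.2) (hn : PolyTime n) (he : PolyTime e) :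
    PolyTime fun a => (Nat.rec (e a) (fun i s => op s (x a i)) (n a) : σ) := by
  have hmore : PolyTime fun c : ℕ × ℕ => decide (0 < c.2 - c.1) := by
    have := fst'.natCast.intLt (snd' (α := ℕ) (β := ℕ)).natCast
    refine (funext fun c => ?_ : (fun c : ℕ × ℕ => decide (0 < c.2 - c.1)) = _) ▸ this
    simp
  have h := (iterate_op (κ := ℕ × ℕ) (next := fun c => (c.1 + 1, c.2)) (fun c => c.2 - c.1) hmore
    ((fst'.natAdd (const 1)).pair snd') fst' hop hx (fun c => by simp only [meas]; omega)
    (fun c => by simp only; omega)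
    (fun c => by simp only [meas]; omega) K hK).comp (((const 0).pair hn).pair (id.pair he))
  have key : ∀ a n s i, (fun z : (ℕ × ℕ) × α × σ => ((z.1.1 + 1, z.1.2), z.2.1,
      op z.2.2 (x z.2.1 z.1.1)))^[i] ((0, n), a, s) =
      ((i, n), a, Nat.rec s (fun i s => op s (x a i)) i) := by
    intro a n s i
    induction i with
    | zero => rfl
    | succ i ih => rw [Function.iterate_succ_apply', ih]
  simpa only [key, Nat.sub_zero] using h

theorem intPow {f : α → ℤ} {n : α → ℕ} (hf : PolyTime f) (hn : PolyTime n) :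
    PolyTime fun a => f a ^ n a := by
  have h := natRec (σ := ℤ) (β := ℤ) (op := fun s b => s * b) (x := fun a _ => f a)
    (fst'.intMul snd') 1 (fun s b => by
      have := size_natAbs_mul s b
      simp only [meas, Val.size]; omega) (hf.comp fst') hn (const 1)
  refine (funext fun a => ?_ : (fun a => f a ^ n a) = _) ▸ h
  induction n a with
  | zero => exact pow_zero _
  | succ n ih => rw [pow_succ, ih]

theorem length {l : α → List β} [Inhabited β] (hl : PolyTime l) :
    PolyTime fun a => (l a).length := by
  have h := foldl (σ := ℕ) (β := Bool) (op := fun s _ => s + 1) (x := fun _ _ => true)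
    (fst'.natAdd (const 1)) 1 (fun s b => by
      have := one_le_meas b
      simp only [meas] at *; omega) (const true) hl (const 0)
  refine (funext fun a => ?_ : (fun a => (l a).length) = _) ▸ h
  have : ∀ (l : List β) n, l.foldl (fun s _ => s + 1) n = n + l.length := by
    intro l
    induction l with
    | nil => simp
    | cons b l ih => intro n; rw [List.foldl_cons, ih, List.length_cons]; omega
  rw [this, zero_add]

theorem natSum {n : ℕ} {g : Fin n → α → ℕ} (hg : ∀ j, PolyTime (g j)) :
    PolyTime fun a => ∑ j, g j a := by
  simpa only [← List.sum_ofFn, List.sum] using foldr_ofFn (fst'.natAdd snd') 0 hg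

theorem intProd {n : ℕ} {g : Fin n → α → ℤ} (hg : ∀ j, PolyTime (g j)) :
    PolyTime fun a => ∏ j, g j a := by
  simpa only [← List.prod_ofFn, List.prod] using foldr_ofFn (fst'.intMul snd') 1 hg

end PolyTime

/-! ### Sparse polynomials and the Euler operator -/

/-- The Euler operator `X * d/dX`.  It is a derivation that multiplies the coefficient of `X ^ n`
by `n`, so unlike `d/dX` it does not move the support. -/
noncomputable def euler (f : ℝ[X]) : ℝ[X] := X * derivative f

theorem euler_mul (f g : ℝ[X]) : euler (f * g) = euler f * g + f * euler g := by
  simp only [euler, derivative_mul]; ring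

theorem euler_sum {ι : Type*} (s : Finset ι) (f : ι → ℝ[X]) :
    euler (∑ i ∈ s, f i) = ∑ i ∈ s, euler (f i) := by
  simp only [euler, derivative_sum, Finset.mul_sum]

theorem coeff_euler (f : ℝ[X]) (n : ℕ) : (euler f).coeff n = n * f.coeff n := by
  cases n with
  | zero => simp [euler]
  | succ n => rw [euler, coeff_X_mul, coeff_derivative]; push_cast; ring

theorem support_euler_subset (f : ℝ[X]) : (euler f).support ⊆ f.support := by
  intro n hn
  rw [mem_support_iff, coeff_euler] at hn
  exact mem_support_iff.2 (right_ne_zero_of_mul hn)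

theorem support_mul_subset_add {f g : ℝ[X]} {S T : Finset ℕ} (hf : f.support ⊆ S)
    (hg : g.support ⊆ T) : (f * g).support ⊆ Finset.image₂ (· + ·) S T := by
  intro n hn
  rw [mem_support_iff, coeff_mul] at hn
  obtain ⟨x, hx, h⟩ := Finset.exists_ne_zero_of_sum_ne_zero hn
  exact Finset.mem_image₂.2 ⟨x.1, hf (mem_support_iff.2 (left_ne_zero_of_mul h)), x.2,
    hg (mem_support_iff.2 (right_ne_zero_of_mul h)), Finset.HasAntidiagonal.mem_antidiagonal.1 hx⟩

theorem support_add_subset_of {f g : ℝ[X]} {S : Finset ℕ} (hf : f.support ⊆ S)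
    (hg : g.support ⊆ S) : (f + g).support ⊆ S :=
  support_add.trans (Finset.union_subset hf hg)

theorem support_sub_subset_of {f g : ℝ[X]} {S : Finset ℕ} (hf : f.support ⊆ S)
    (hg : g.support ⊆ S) : (f - g).support ⊆ S := by
  rw [sub_eq_add_neg]
  exact support_add_subset_of hf (by rwa [support_neg])

/-- If `e` is in the support of `f`, then `euler f - e * f` has one monomial fewer, and its order at
`1` drops by at most one. -/
theorem rootMultiplicity_one_lt_card_support (f : ℝ[X]) (hf : f ≠ 0) :
    f.rootMultiplicity 1 < f.support.card := by
  induction h : f.support.card using Nat.strong_induction_on generalizing f with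
  | _ s ih =>
    obtain ⟨e, he⟩ := (support_nonempty (p := f)).2 hf
    by_cases hg : euler f - C (e : ℝ) * f = 0
    · -- `f` is a monomial
      have hf1 : f = monomial e (f.coeff e) := by
        ext n
        rw [coeff_monomial]
        split_ifs with hn
        · rw [hn]
        · have := congrArg (fun p => coeff p n) hg
          simp only [coeff_sub, coeff_euler, coeff_C_mul, coeff_zero, ← sub_mul] at this
          refine (mul_eq_zero.1 this).resolve_left (sub_ne_zero.2 ?_)
          exact_mod_cast Ne.symm hn
      have h1 : ¬ f.IsRoot 1 := by
        rw [hf1]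
        simpa [eval_monomial] using mem_support_iff.1 he
      rw [rootMultiplicity_eq_zero h1, ← h]
      exact Finset.card_pos.2 ⟨e, he⟩
    · have hsub : (euler f - C (e : ℝ) * f).support ⊆ f.support.erase e := by
        intro n hn
        rw [mem_support_iff, coeff_sub, coeff_euler, coeff_C_mul, ← sub_mul] at hn
        refine Finset.mem_erase.2 ⟨?_, mem_support_iff.2 (right_ne_zero_of_mul hn)⟩
        rintro rfl
        simp at hn
      have hcard := Finset.card_le_card hsub
      rw [Finset.card_erase_of_mem he] at hcard
      have hpos := Finset.card_pos.2 ⟨e, he⟩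
      have h2 := ih _ (by omega) _ hg rfl
      have h3 : f.rootMultiplicity 1 - 1 ≤ (euler f - C (e : ℝ) * f).rootMultiplicity 1 := by
        rw [le_rootMultiplicity_iff hg]
        have h4 := pow_rootMultiplicity_dvd f 1
        have h5 : (X - C (1 : ℝ)) ^ (f.rootMultiplicity 1 - 1) ∣ derivative f :=
          pow_sub_one_dvd_derivative_of_pow_dvd h4
        exact dvd_sub (h5.mul_left _) (((pow_dvd_pow _ (Nat.sub_le _ _)).trans h4).mul_left _)
      omega

/-! ### Vanishing order at `1` of sums of products -/

/-- If `f` vanishes at `1` to a higher order than `g`, then their Wronskian is nonzero and its order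
is determined: the leading terms of the two products at `1` cannot cancel. -/
theorem rootMultiplicity_wronskian {f g : ℝ[X]} (hf : f ≠ 0) (hg : g ≠ 0)
    (h : g.rootMultiplicity 1 < f.rootMultiplicity 1) :
    euler f * g - f * euler g ≠ 0 ∧ (euler f * g - f * euler g).rootMultiplicity 1 + 1 =
      f.rootMultiplicity 1 + g.rootMultiplicity 1 := by
  obtain ⟨u, hu, hu1⟩ := exists_eq_pow_rootMultiplicity_mul_and_not_dvd f hf 1
  obtain ⟨v, hv, hv1⟩ := exists_eq_pow_rootMultiplicity_mul_and_not_dvd g hg 1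
  rw [dvd_iff_isRoot, IsRoot.def] at hu1 hv1
  generalize f.rootMultiplicity 1 = a at *
  generalize g.rootMultiplicity 1 = b at *
  obtain ⟨a, rfl⟩ : ∃ a', a = a' + 1 := ⟨a - 1, by omega⟩
  -- the cofactor, which does not vanish at `1` because `b < a + 1`
  let E : ℝ[X] := X * ((C ((a + 1 : ℝ) - b)) * (u * v) +
    (X - C 1) * (derivative u * v - u * derivative v))
  have hE : eval 1 E ≠ 0 := by
    have : (b : ℝ) < a + 1 := by exact_mod_cast h
    simp only [E, eval_mul, eval_add, eval_sub, eval_X, eval_C, sub_self, zero_mul, add_zero,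
      one_mul]
    exact mul_ne_zero (by linarith) (mul_ne_zero hu1 hv1)
  have hE0 : E ≠ 0 := by rintro h0; simp [h0] at hE
  have hd : euler f * g - f * euler g = (X - C 1) ^ (a + b) * E := by
    have hpow : ∀ n : ℕ, derivative ((X - C (1 : ℝ)) ^ n) * (X - C 1) = C (n : ℝ) * (X - C 1) ^ n := by
      intro n
      rw [derivative_X_sub_C_pow]
      cases n with
      | zero => simp
      | succ n => simp only [Nat.add_sub_cancel]; rw [pow_succ]; simp; ring
    have hb := hpow b
    apply mul_right_cancel₀ (X_sub_C_ne_zero (1 : ℝ))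
    rw [hu, hv]
    simp only [euler, derivative_mul, derivative_X_sub_C_pow, Nat.add_sub_cancel] at hb ⊢
    simp only [E, C_sub, C_add, map_natCast, map_one, Nat.cast_add, Nat.cast_one] at hb ⊢
    linear_combination (-X * u * v * (X - 1) ^ (a + 1)) * hb
  have hne : (X - C (1 : ℝ)) ^ (a + b) * E ≠ 0 :=
    mul_ne_zero (pow_ne_zero _ (X_sub_C_ne_zero 1)) hE0
  rw [hd]
  refine ⟨hne, ?_⟩
  rw [rootMultiplicity_mul hne, rootMultiplicity_X_sub_C_pow,
    rootMultiplicity_eq_zero (p := E) (by simpa using hE)]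
  omega

/-- The logarithmic Euler derivative of `g` is `w / F` for some `w` with support in `S`.  The condition
is multiplicative in `g`, so `F` and `S` serve all power products of a family at once. -/
def LogDerivIn (F : ℝ[X]) (S : Finset ℕ) (g : ℝ[X]) : Prop :=
  ∃ w : ℝ[X], w.support ⊆ S ∧ euler g * F = g * w

theorem LogDerivIn.one (F : ℝ[X]) (S : Finset ℕ) : LogDerivIn F S 1 :=
  ⟨0, by simp, by simp [euler]⟩

theorem LogDerivIn.mul {F g h : ℝ[X]} {S : Finset ℕ} (hg : LogDerivIn F S g)
    (hh : LogDerivIn F S h) : LogDerivIn F S (g * h) := by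
  obtain ⟨v, hv, hgv⟩ := hg
  obtain ⟨w, hw, hhw⟩ := hh
  refine ⟨v + w, support_add_subset_of hv hw, ?_⟩
  rw [euler_mul]
  linear_combination h * hgv + g * hhw

theorem LogDerivIn.pow {F g : ℝ[X]} {S : Finset ℕ} (hg : LogDerivIn F S g) (n : ℕ) :
    LogDerivIn F S (g ^ n) := by
  induction n with
  | zero => simpa using LogDerivIn.one F S
  | succ n ih => simpa only [pow_succ] using ih.mul hg

theorem LogDerivIn.prod {ι : Type*} {F : ℝ[X]} {S : Finset ℕ} (s : Finset ι) {g : ι → ℝ[X]}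
    (hg : ∀ i ∈ s, LogDerivIn F S (g i)) : LogDerivIn F S (∏ i ∈ s, g i) :=
  Finset.prod_induction _ _ (fun _ _ => LogDerivIn.mul) (LogDerivIn.one F S) hg

theorem exists_support_prod_subset {m t : ℕ} (T : Fin m → Finset ℕ) (hT : ∀ j, (T j).card ≤ t) :
    ∃ S : Finset ℕ, S.card ≤ t ^ m ∧
      ∀ h : Fin m → ℝ[X], (∀ j, (h j).support ⊆ T j) → (∏ j, h j).support ⊆ S := by
  induction m with
  | zero => exact ⟨{0}, by simp, fun h _ => by simpa using support_C_subset (1 : ℝ)⟩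
  | succ m ih =>
    obtain ⟨S, hS, h⟩ := ih (fun j => T j.succ) fun j => hT j.succ
    refine ⟨Finset.image₂ (· + ·) (T 0) S, ?_, fun g hg => ?_⟩
    · rw [pow_succ']
      exact Finset.card_image₂_le _ _ _ |>.trans (Nat.mul_le_mul (hT 0) hS)
    · rw [Fin.prod_univ_succ]
      exact support_mul_subset_add (hg 0) (h _ fun j => hg j.succ)

/-- With `F` the product of the family, the numerators of the logarithmic derivatives are products
of the members with one of them replaced by its Euler derivative, so their supports lie in a common
sumset. -/
theorem exists_logDerivIn {m t : ℕ} (f : Fin m → ℝ[X]) (hf : ∀ j, (f j).support.card ≤ t) :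
    ∃ S : Finset ℕ, S.card ≤ t ^ m ∧ (∏ j, f j).support ⊆ S ∧
      ∀ j, LogDerivIn (∏ j, f j) S (f j) := by
  obtain ⟨S, hS, h⟩ := exists_support_prod_subset (fun j => (f j).support) hf
  refine ⟨S, hS, h f fun _ => Finset.Subset.refl _, fun j => ?_⟩
  refine ⟨∏ l, Function.update f j (euler (f j)) l, h _ fun l => ?_, ?_⟩
  · by_cases hl : l = j
    · subst hl; simpa using support_euler_subset (f l)
    · simp [hl]
  · rw [Finset.prod_update_of_mem (Finset.mem_univ j),
      ← Finset.mul_prod_erase Finset.univ f (Finset.mem_univ j), Finset.sdiff_singleton_eq_erase]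
    ring

/-- Elimination of the summand `P 0 * g 0` by a Wronskian replaces the sparsity `s` of the coefficients
by `s * s * S.card` and costs one in the order; this leads to the exponents `2 ^ k`. -/
theorem rootMultiplicity_sum_le {F : ℝ[X]} (hF : F ≠ 0) {S : Finset ℕ} (hFS : F.support ⊆ S)
    {R : ℕ} {k : ℕ} (g : Fin k → ℝ[X]) (hg0 : ∀ i, g i ≠ 0)
    (hgR : ∀ i, (g i).rootMultiplicity 1 ≤ R) (hg : ∀ i, LogDerivIn F S (g i))
    (P : Fin k → ℝ[X]) (s : ℕ) (hs : 0 < s) (hP : ∀ i, (P i).support.card ≤ s)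
    (hne : ∑ i, P i * g i ≠ 0) :
    (∑ i, P i * g i).rootMultiplicity 1 ≤ s ^ 2 ^ k * S.card ^ 2 ^ k + R + k := by
  have hS : 0 < S.card :=
    Finset.card_pos.2 ((Finset.nonempty_iff_ne_empty.2 fun h => hF (support_eq_empty.1 h)).mono hFS)
  induction k generalizing s with
  | zero => simp at hne
  | succ k ih =>
    have hs' : s ^ 2 ^ k ≤ s ^ 2 ^ (k + 1) :=
      Nat.pow_le_pow_right hs (Nat.pow_le_pow_right (by norm_num) (Nat.le_succ k))
    have hS' : S.card ^ 2 ^ k ≤ S.card ^ 2 ^ (k + 1) :=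
      Nat.pow_le_pow_right hS (Nat.pow_le_pow_right (by norm_num) (Nat.le_succ k))
    -- a vanishing coefficient cannot be eliminated by a Wronskian; the summand is dropped instead
    by_cases hP0 : P 0 = 0
    · rw [Fin.sum_univ_succ, hP0, zero_mul, zero_add] at hne ⊢
      have h1 := ih (fun i => g i.succ) (fun i => hg0 _) (fun i => hgR _) (fun i => hg _)
        (fun i => P i.succ) s hs (fun i => hP _) hne
      have := Nat.mul_le_mul hs' hS'
      omega
    have hq0 : P 0 * g 0 ≠ 0 := mul_ne_zero hP0 (hg0 0)
    set φ := ∑ i, P i * g i with hφ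
    have hqm := rootMultiplicity_mul (x := 1) hq0
    by_cases hle : φ.rootMultiplicity 1 ≤ (P 0 * g 0).rootMultiplicity 1
    · have h1 := rootMultiplicity_one_lt_card_support (P 0) hP0
      have h2 := hP 0
      have h3 := hgR 0
      have h4 : s ≤ s ^ 2 ^ (k + 1) * S.card ^ 2 ^ (k + 1) :=
        (Nat.le_self_pow (by positivity) s).trans (Nat.le_mul_of_pos_right _ (Nat.pow_pos hS))
      omega
    obtain ⟨hW, hWm⟩ := rootMultiplicity_wronskian hne hq0 (not_le.1 hle)
    choose w hwS hw using hg
    let Q : Fin k → ℝ[X] := fun i =>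
      (euler (P i.succ) * P 0 - P i.succ * euler (P 0)) * F +
        P i.succ * P 0 * (w i.succ - w 0)
    -- `Q i` is `F` times the Wronskian of `P (i + 1) * g (i + 1)` and `P 0 * g 0`, divided by
    -- `g (i + 1) * g 0`
    have hWF : (euler φ * (P 0 * g 0) - φ * euler (P 0 * g 0)) * F =
        g 0 * ∑ i, Q i * g i.succ := by
      rw [hφ, Fin.sum_univ_succ, euler_mul, ← sub_eq_zero]
      set ψ := ∑ i : Fin k, P i.succ * g i.succ
      have h1 : (euler ψ * (P 0 * g 0) - ψ * (euler (P 0) * g 0 + P 0 * euler (g 0))) * F =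
          g 0 * ∑ i, Q i * g i.succ := by
        simp only [ψ, euler_sum, Finset.sum_mul, Finset.mul_sum, ← Finset.sum_sub_distrib]
        refine Finset.sum_congr rfl fun i _ => ?_
        rw [euler_mul]
        linear_combination (P i.succ * P 0 * g 0) * hw i.succ - (P i.succ * P 0 * g i.succ) * hw 0
      rw [← h1]
      simp only [euler, derivative_add, derivative_mul]
      ring
    have hne' : g 0 * ∑ i, Q i * g i.succ ≠ 0 := hWF ▸ mul_ne_zero hW hF
    have hm := congrArg (rootMultiplicity 1) hWF
    rw [rootMultiplicity_mul hne', rootMultiplicity_mul (mul_ne_zero hW hF)] at hm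
    have hQ : ∀ i, (Q i).support.card ≤ s * s * S.card := by
      intro i
      have hsub : (Q i).support ⊆
          Finset.image₂ (· + ·) (Finset.image₂ (· + ·) (P i.succ).support (P 0).support) S :=
        support_add_subset_of
          (support_mul_subset_add (support_sub_subset_of
            (support_mul_subset_add (support_euler_subset _) (Finset.Subset.refl _))
            (support_mul_subset_add (Finset.Subset.refl _) (support_euler_subset _))) hFS)
          (support_mul_subset_add
            (support_mul_subset_add (Finset.Subset.refl _) (Finset.Subset.refl _))
            (support_sub_subset_of (hwS _) (hwS _)))
      refine (Finset.card_le_card hsub).trans ((Finset.card_image₂_le _ _ _).trans ?_)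
      exact Nat.mul_le_mul_right _
        ((Finset.card_image₂_le _ _ _).trans (Nat.mul_le_mul (hP _) (hP _)))
    have h1 := ih (fun i => g i.succ) (fun i => hg0 _) (fun i => hgR _)
      (fun i => ⟨w i.succ, hwS _, hw _⟩) Q (s * s * S.card)
      (Nat.mul_pos (Nat.mul_pos hs hs) hS) hQ (right_ne_zero_of_mul hne')
    have h2 : (s * s * S.card) ^ 2 ^ k * S.card ^ 2 ^ k =
        s ^ 2 ^ (k + 1) * S.card ^ 2 ^ (k + 1) := by
      rw [pow_succ 2 k, pow_mul, pow_mul]; ring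
    rw [h2] at h1
    omega

theorem rootMultiplicity_prod_pow_le {m t : ℕ} (f : Fin m → ℝ[X]) (hf0 : ∀ j, f j ≠ 0)
    (hf : ∀ j, (f j).support.card ≤ t) (a : Fin m → ℕ) :
    (∏ j, f j ^ a j).rootMultiplicity 1 ≤ (∑ j, a j) * t := by
  have hpow : ∀ (p : ℝ[X]) (n : ℕ), p ≠ 0 → (p ^ n).rootMultiplicity 1 =
      n * p.rootMultiplicity 1 := by
    intro p n hp
    rw [← count_roots, ← count_roots, roots_pow, Multiset.count_nsmul]
  induction m with
  | zero =>
    have : ¬ (1 : ℝ[X]).IsRoot 1 := by simp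
    simp [rootMultiplicity_eq_zero this]
  | succ m ih =>
    rw [Fin.prod_univ_succ, Fin.sum_univ_succ, add_mul, rootMultiplicity_mul
      (mul_ne_zero (pow_ne_zero _ (hf0 0)) (Finset.prod_ne_zero_iff.2 fun j _ =>
        pow_ne_zero _ (hf0 _))), hpow _ _ (hf0 0)]
    have := rootMultiplicity_one_lt_card_support _ (hf0 0)
    exact Nat.add_le_add (Nat.mul_le_mul_left _ (this.le.trans (hf 0)))
      (ih _ (fun j => hf0 _) (fun j => hf _) _)

theorem rootMultiplicity_sum_prod_pow_le {k m t A : ℕ} (f : Fin m → ℝ[X]) (hf0 : ∀ j, f j ≠ 0)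
    (hf : ∀ j, (f j).support.card ≤ t) (α : Fin k → Fin m → ℕ) (hA : ∀ i, ∑ j, α i j ≤ A)
    (hne : ∑ i, ∏ j, f j ^ α i j ≠ 0) :
    (∑ i, ∏ j, f j ^ α i j).rootMultiplicity 1 ≤ t ^ (m * 2 ^ k) + A * t + k := by
  obtain ⟨S, hS, hFS, hlog⟩ := exists_logDerivIn f hf
  have h := rootMultiplicity_sum_le (Finset.prod_ne_zero_iff.2 fun j _ => hf0 j) hFS
    (R := A * t) (fun i => ∏ j, f j ^ α i j)
    (fun i => Finset.prod_ne_zero_iff.2 fun j _ => pow_ne_zero _ (hf0 j))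
    (fun i => (rootMultiplicity_prod_pow_le f hf0 hf (α i)).trans (Nat.mul_le_mul_right _ (hA i)))
    (fun i => LogDerivIn.prod _ fun j _ => (hlog j).pow _) (fun _ => 1) 1 one_pos
    (fun i => by
      have : (1 : ℝ[X]).support.card ≤ 1 := by
        simpa using card_support_C_mul_X_pow_le_one (c := (1 : ℝ)) (n := 0)
      exact this) (by simpa using hne)
  simp only [one_mul, one_pow] at h
  refine h.trans ?_
  rw [pow_mul]
  have := Nat.pow_le_pow_left hS (2 ^ k)
  omega

/-! ### Separating zero from nonzero low-order coefficients -/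

/-- Some positive integer multiple `Δ * F` with `Δ ≤ K` has integer coefficients whose absolute values
sum to at most `K`.  The sum is expressed through a polynomial `H` that majorizes the coefficients,
as the value `H.eval 1`; this makes products easy to estimate. -/
def HeightLE (F : ℝ[X]) (K : ℕ) : Prop :=
  ∃ (Δ : ℕ) (G : ℤ[X]) (H : ℕ[X]), 0 < Δ ∧ Δ ≤ K ∧
    G.map (Int.castRingHom ℝ) = C (Δ : ℝ) * F ∧
    (∀ i, (G.coeff i).natAbs ≤ H.coeff i) ∧ H.eval 1 ≤ K

namespace HeightLE

variable {F F' : ℝ[X]} {K K' : ℕ}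

theorem mono (h : HeightLE F K) (hK : K ≤ K') : HeightLE F K' := by
  obtain ⟨Δ, G, H, h0, h1, h2, h3, h4⟩ := h
  exact ⟨Δ, G, H, h0, h1.trans hK, h2, h3, h4.trans hK⟩

theorem of_int (G : ℤ[X]) (H : ℕ[X]) (hGH : ∀ i, (G.coeff i).natAbs ≤ H.coeff i)
    (hK : H.eval 1 ≤ K) (h1 : 1 ≤ K) : HeightLE (G.map (Int.castRingHom ℝ)) K :=
  ⟨1, G, H, one_pos, h1, by simp, hGH, hK⟩

theorem zero : HeightLE 0 1 := by
  simpa using of_int (K := 1) 0 0 (by simp) (by simp) le_rfl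

theorem one : HeightLE 1 1 := by
  simpa using of_int (K := 1) 1 1 (fun i => by simp only [coeff_one]; split_ifs <;> simp)
    (by simp) le_rfl

theorem add (h : HeightLE F K) (h' : HeightLE F' K') : HeightLE (F + F') (2 * K * K') := by
  obtain ⟨Δ, G, H, h0, h1, h2, h3, h4⟩ := h
  obtain ⟨Δ', G', H', h0', h1', h2', h3', h4'⟩ := h'
  refine ⟨Δ * Δ', C (Δ' : ℤ) * G + C (Δ : ℤ) * G', C Δ' * H + C Δ * H', Nat.mul_pos h0 h0', ?_, ?_,
    fun i => ?_, ?_⟩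
  · have := Nat.mul_le_mul h1 h1'
    rw [mul_assoc]; omega
  · simp [h2, h2']
    ring
  · simp only [coeff_add, coeff_C_mul]
    refine (Int.natAbs_add_le _ _).trans ?_
    simp only [Int.natAbs_mul, Int.natAbs_natCast]
    exact Nat.add_le_add (Nat.mul_le_mul_left _ (h3 i)) (Nat.mul_le_mul_left _ (h3' i))
  · simp only [eval_add, eval_mul, eval_C]
    have a := Nat.mul_le_mul h1' h4
    have b := Nat.mul_le_mul h1 h4'
    rw [mul_comm K' K] at a
    rw [mul_assoc]; omega

theorem mul (h : HeightLE F K) (h' : HeightLE F' K') : HeightLE (F * F') (K * K') := by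
  obtain ⟨Δ, G, H, h0, h1, h2, h3, h4⟩ := h
  obtain ⟨Δ', G', H', h0', h1', h2', h3', h4'⟩ := h'
  refine ⟨Δ * Δ', G * G', H * H', Nat.mul_pos h0 h0', Nat.mul_le_mul h1 h1', ?_,
    fun i => ?_, ?_⟩
  · simp only [Polynomial.map_mul, h2, h2', Nat.cast_mul, C_mul]
    ring
  · rw [coeff_mul, coeff_mul]
    refine (Int.natAbs_sum_le _ _).trans (Finset.sum_le_sum fun x _ => ?_)
    rw [Int.natAbs_mul]
    exact Nat.mul_le_mul (h3 _) (h3' _)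
  · rw [eval_mul]
    exact Nat.mul_le_mul h4 h4'

theorem pow (h : HeightLE F K) (n : ℕ) : HeightLE (F ^ n) (K ^ n) := by
  induction n with
  | zero => simpa using one
  | succ n ih => simpa only [pow_succ] using ih.mul h

theorem list_sum {ι : Type*} {f : ι → ℝ[X]} {B : ι → ℕ} (l : List ι)
    (h : ∀ i ∈ l, HeightLE (f i) (B i)) : HeightLE (l.map f).sum (l.map fun i => 2 * B i).prod := by
  induction l with
  | nil => simpa using zero
  | cons i l ih =>
    simp only [List.map_cons, List.sum_cons, List.prod_cons]
    exact (h i (by simp)).add (ih fun j hj => h j (by simp [hj]))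

theorem sum {n : ℕ} {f : Fin n → ℝ[X]} {B : Fin n → ℕ} (h : ∀ i, HeightLE (f i) (B i)) :
    HeightLE (∑ i, f i) (∏ i, 2 * B i) := by
  have := list_sum (List.finRange n) fun i _ => h i
  rwa [← List.ofFn_eq_map, ← List.ofFn_eq_map, List.sum_ofFn, List.prod_ofFn] at this

theorem prod {n : ℕ} {f : Fin n → ℝ[X]} {B : Fin n → ℕ} (h : ∀ i, HeightLE (f i) (B i)) :
    HeightLE (∏ i, f i) (∏ i, B i) := by
  induction n with
  | zero => simpa using one
  | succ n ih =>
    rw [Fin.prod_univ_succ, Fin.prod_univ_succ]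
    exact (h 0).mul (ih fun i => h i.succ)

end HeightLE

/-- For small `y`, a polynomial of order at least `r` at `0` is close to its term of degree `r`. -/
theorem abs_eval_sub_le {G : ℤ[X]} {H : ℕ[X]} (hGH : ∀ i, (G.coeff i).natAbs ≤ H.coeff i) {r : ℕ}
    (hr : ∀ i < r, G.coeff i = 0) {y : ℝ} (hy0 : 0 ≤ y) (hy1 : y ≤ 1) :
    |(G.map (Int.castRingHom ℝ)).eval y - G.coeff r * y ^ r| ≤ y ^ (r + 1) * H.eval 1 := by
  set g := G.map (Int.castRingHom ℝ)
  set n := g.natDegree + H.natDegree + r + 1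
  have hgc : ∀ i, g.coeff i = (G.coeff i : ℝ) := fun i => by simp [g]
  rw [eval_eq_sum_range' (n := n) (by omega) y, eval_eq_sum_range' (n := n) (by omega) 1,
    ← Finset.sum_erase_add _ _ (Finset.mem_range.2 (show r < n by omega)), hgc r,
    add_sub_cancel_right]
  refine (Finset.abs_sum_le_sum_abs _ _).trans ?_
  push_cast
  rw [Finset.mul_sum]
  refine (Finset.sum_le_sum (g := fun i => y ^ (r + 1) * ((H.coeff i : ℝ) * 1 ^ i))
    fun i hi => ?_).trans
    (Finset.sum_le_sum_of_subset_of_nonneg (Finset.erase_subset _ _) fun i _ _ => by positivity)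
  rw [hgc, abs_mul, abs_of_nonneg (pow_nonneg hy0 i), one_pow, mul_one, mul_comm]
  rcases lt_trichotomy i r with h | h | h
  · rw [hr i h]
    simp only [Int.cast_zero, abs_zero, mul_zero]
    positivity
  · exact absurd h (Finset.ne_of_mem_erase hi)
  · refine mul_le_mul (pow_le_pow_of_le_one hy0 hy1 h) ?_ (abs_nonneg _) (by positivity)
    rw [← Int.cast_abs, Int.abs_eq_natAbs]
    exact_mod_cast hGH i

/-- The two cases are separated by a gap: if `X ^ N ∣ F` then `|F y| ≤ K * y ^ N` for `y = 1 / c ^ 2`,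
and otherwise `|F y| ≥ y ^ (N - 1) / (2 * K)`.  Squares replace absolute values in the conclusion, so
that it can be tested by integer arithmetic without case distinctions. -/
theorem X_pow_dvd_iff_eval_small {F : ℝ[X]} {K : ℕ} (h : HeightLE F K) {N : ℕ} (hN : 0 < N)
    {c : ℝ} (hc : 2 * K ≤ c) :
    X ^ N ∣ F ↔ (F.eval (c ^ 2)⁻¹) ^ 2 * c ^ (4 * N) < c ^ 2 := by
  obtain ⟨Δ, G, H, h0, h1, h2, h3, h4⟩ := h
  have hΔ : (1 : ℝ) ≤ Δ := by exact_mod_cast h0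
  have hΔK : (Δ : ℝ) ≤ K := by exact_mod_cast h1
  have hHK : ((H.eval 1 : ℕ) : ℝ) ≤ K := by exact_mod_cast h4
  have hc2 : 2 ≤ c := by linarith
  have hc0 : 0 < c := by linarith
  set y := (c ^ 2)⁻¹ with hy
  have hyc : y * c ^ 2 = 1 := inv_mul_cancel₀ (by positivity)
  have hy0 : 0 < y := by positivity
  have hy1 : y ≤ 1 := by nlinarith
  have hev : (G.map (Int.castRingHom ℝ)).eval y = Δ * F.eval y := by rw [h2]; simp
  have hcoef : ∀ i, (G.coeff i : ℝ) = Δ * F.coeff i := fun i => by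
    have := congrArg (fun p => coeff p i) h2
    simpa using this
  have hcoef0 : ∀ i, F.coeff i = 0 ↔ G.coeff i = 0 := fun i => by
    rw [← Int.cast_eq_zero (α := ℝ), hcoef, mul_eq_zero, or_iff_right (by positivity)]
  have hsq : (F.eval y) ^ 2 * c ^ (4 * N) < c ^ 2 ↔ |F.eval y| * c ^ (2 * N) < c := by
    have : (F.eval y) ^ 2 * c ^ (4 * N) = (|F.eval y| * c ^ (2 * N)) ^ 2 := by
      rw [mul_pow, sq_abs, ← pow_mul]; ring_nf
    rw [this, sq_lt_sq₀ (by positivity) hc0.le]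
  rw [hsq]
  constructor
  · intro hd
    rw [X_pow_dvd_iff] at hd
    -- the term of degree `N - 1` is zero, so the estimate gives order `N`
    have hb := abs_eval_sub_le h3 (r := N - 1)
      (fun i hi => (hcoef0 i).1 (hd i (by omega))) hy0.le hy1
    rw [(hcoef0 _).1 (hd (N - 1) (by omega)), Int.cast_zero, zero_mul, sub_zero, hev, abs_mul,
      abs_of_pos (by linarith : (0 : ℝ) < Δ), Nat.sub_add_cancel hN] at hb
    calc |F.eval y| * c ^ (2 * N) ≤ (Δ * |F.eval y|) * c ^ (2 * N) := by
          gcongr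
          exact le_mul_of_one_le_left (abs_nonneg _) hΔ
      _ ≤ y ^ N * K * c ^ (2 * N) :=
          mul_le_mul_of_nonneg_right (hb.trans (by gcongr)) (by positivity)
      _ = K * (y * c ^ 2) ^ N := by rw [mul_pow, ← pow_mul]; ring
      _ = K := by rw [hyc, one_pow, mul_one]
      _ < c := by linarith
  · intro hlt
    rw [X_pow_dvd_iff]
    by_contra hne
    push Not at hne
    have hex : ∃ i, F.coeff i ≠ 0 := ⟨_, hne.choose_spec.2⟩
    classical
    set r := Nat.find hex with hr
    have hrN : r < N := (Nat.find_min' hex hne.choose_spec.2).trans_lt hne.choose_spec.1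
    have hb := abs_eval_sub_le h3 (r := r)
      (fun i hi => (hcoef0 i).1 (not_not.1 (Nat.find_min hex hi))) hy0.le hy1
    have hgr : (1 : ℝ) ≤ |(G.coeff r : ℝ)| := by
      rw [← Int.cast_abs]
      exact_mod_cast Int.one_le_abs fun h => Nat.find_spec hex ((hcoef0 r).2 h)
    have hlow : y ^ r * (1 - y * K) ≤ Δ * |F.eval y| := by
      have a := abs_sub_abs_le_abs_sub ((G.coeff r : ℝ) * y ^ r)
        ((G.map (Int.castRingHom ℝ)).eval y)
      rw [abs_sub_comm, hev, abs_mul, abs_mul, abs_of_pos (by linarith : (0 : ℝ) < Δ),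
        abs_of_pos (by positivity : 0 < y ^ r)] at a
      rw [hev] at hb
      have e1 : y ^ (r + 1) * ((H.eval 1 : ℕ) : ℝ) ≤ y ^ (r + 1) * K := by gcongr
      have e2 : y ^ r ≤ |(G.coeff r : ℝ)| * y ^ r := le_mul_of_one_le_left (by positivity) hgr
      rw [pow_succ] at e1 hb
      linarith
    have hyK : y * K ≤ 1 / 2 := by
      have : y * c ≤ 1 := by nlinarith
      nlinarith
    have hyr : y ^ (N - 1) ≤ y ^ r := pow_le_pow_of_le_one hy0.le hy1 (by omega)
    have hpos : 0 < y ^ (N - 1) := by positivity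
    have h5 : y ^ (N - 1) ≤ c * |F.eval y| := by
      have e1 : y ^ r * (1 / 2) ≤ Δ * |F.eval y| :=
        (mul_le_mul_of_nonneg_left (by linarith) (by positivity)).trans hlow
      have e2 : (Δ : ℝ) * |F.eval y| ≤ K * |F.eval y| := by gcongr
      have e3 : 2 * (K : ℝ) * |F.eval y| ≤ c * |F.eval y| := by gcongr
      linarith
    have h6 : y ^ (N - 1) * c ^ (2 * N) = c ^ 2 := by
      obtain ⟨n, rfl⟩ : ∃ n, N = n + 1 := ⟨N - 1, by omega⟩
      rw [Nat.add_sub_cancel, show 2 * (n + 1) = 2 * n + 2 by ring, pow_add, pow_mul, ← mul_assoc,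
        ← mul_pow, hyc, one_pow, one_mul]
    have h7 : c ^ 2 ≤ c * (|F.eval y| * c ^ (2 * N)) := by
      rw [← h6, ← mul_assoc]
      gcongr
    nlinarith

/-! ### Truncated Taylor expansions at `1` -/

/-- The polynomial `(1 + X) ^ e` truncated below degree `N`. -/
noncomputable def binomTrunc (N e : ℕ) : ℝ[X] := ∑ r ∈ Finset.range N, C (e.choose r : ℝ) * X ^ r

/-- The Taylor polynomial at `1` of a sparse polynomial, truncated below degree `N`. -/
noncomputable def SparseRep.taylorTrunc (N : ℕ) (l : SparseRep) : ℝ[X] :=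
  (l.map fun s => C (s.1 : ℝ) * binomTrunc N s.2).sum

theorem X_pow_dvd_taylor_sub_taylorTrunc (N : ℕ) (l : SparseRep) :
    X ^ N ∣ taylor 1 l.toPoly - l.taylorTrunc N := by
  induction l with
  | nil => simp [SparseRep.toPoly, SparseRep.taylorTrunc]
  | cons s l ih =>
    simp only [SparseRep.toPoly, SparseRep.taylorTrunc, List.map_cons, List.sum_cons, map_add] at *
    rw [add_sub_add_comm]
    refine dvd_add ?_ ih
    rw [X_pow_dvd_iff]
    intro d hd
    simp [taylor_monomial, coeff_X_add_one_pow, binomTrunc, coeff_X_pow, hd]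

theorem sum_choose_le_pow (e N : ℕ) : ∑ r ∈ Finset.range N, e.choose r ≤ (e + 1) ^ N := by
  rw [add_pow]
  refine (Finset.sum_le_sum fun r hr => ?_).trans
    (Finset.sum_le_sum_of_subset (Finset.range_subset_range.2 (Nat.le_succ N)))
  rw [one_pow, mul_one]
  exact (Nat.choose_le_pow e r).trans (Nat.le_mul_of_pos_right _
    (Nat.choose_pos (Finset.mem_range.1 hr).le))

/-- A bound for the size of a term `c * X ^ e`: twice a number that is at least the numerator in
absolute value, the denominator and the exponent plus one.  The numerator is squared to avoid absolute values in programs. -/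
def termHeight (s : ℚ × ℕ) : ℕ := 2 * ((s.1.num.natAbs ^ 2 + 1) * s.1.den * (s.2 + 1))

theorem heightLE_term (s : ℚ × ℕ) {N : ℕ} (hN : 0 < N) :
    HeightLE (C (s.1 : ℝ) * binomTrunc N s.2)
      (((s.1.num.natAbs ^ 2 + 1) * s.1.den * (s.2 + 1)) ^ N) := by
  set u := s.1.num.natAbs
  have hd : 0 < s.1.den := s.1.den_pos
  have hc : HeightLE (C (s.1 : ℝ)) ((u ^ 2 + 1) * s.1.den) := by
    refine ⟨s.1.den, C s.1.num, C u, hd, Nat.le_mul_of_pos_left _ (by positivity), ?_,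
      fun i => ?_, ?_⟩
    · rw [map_C, ← C_mul, eq_intCast]
      congr 1
      exact_mod_cast (Rat.den_mul_eq_num s.1).symm
    · simp only [coeff_C]
      split_ifs <;> simp [u]
    · rw [eval_C]
      nlinarith [sq_nonneg ((u : ℤ) - 1), Nat.le_self_pow two_ne_zero u]
  have hb : HeightLE (binomTrunc N s.2) ((s.2 + 1) ^ N) := by
    have := HeightLE.of_int (K := (s.2 + 1) ^ N)
      (∑ r ∈ Finset.range N, C (s.2.choose r : ℤ) * X ^ r)
      (∑ r ∈ Finset.range N, C (s.2.choose r) * X ^ r) (fun i => ?_) ?_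
      (Nat.one_le_pow _ _ (by omega))
    · simpa [binomTrunc, Polynomial.map_sum] using this
    · simp only [finsetSum_coeff, coeff_C_mul, coeff_X_pow, mul_ite, mul_one, mul_zero]
      rw [Finset.sum_ite_eq, Finset.sum_ite_eq]
      split_ifs <;> simp
    · simpa [eval_finsetSum] using sum_choose_le_pow s.2 N
  rw [mul_pow]
  exact (hc.mul hb).mono (Nat.mul_le_mul_right _ (Nat.le_self_pow hN.ne' _))

theorem heightLE_taylorTrunc (l : SparseRep) {N : ℕ} (hN : 0 < N) :
    HeightLE (l.taylorTrunc N) ((l.map termHeight).prod ^ N) := by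
  refine (HeightLE.list_sum l fun s _ => heightLE_term s hN).mono ?_
  induction l with
  | nil => simp
  | cons s l ih =>
    simp only [List.map_cons, List.prod_cons, mul_pow] at *
    refine Nat.mul_le_mul ?_ ih
    rw [termHeight, mul_pow _ _ N, mul_pow _ _ N, mul_pow _ _ N]
    exact Nat.mul_le_mul_right _ (Nat.le_self_pow hN.ne' _)

theorem one_le_termHeight (s : ℚ × ℕ) : 1 ≤ termHeight s := by
  have := s.1.den_pos
  have : 0 < termHeight s := by unfold termHeight; positivity
  exact this

theorem eq_zero_iff_X_pow_dvd_taylor {φ : ℝ[X]} {N : ℕ}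
    (h : φ ≠ 0 → φ.rootMultiplicity 1 < N) : φ = 0 ↔ X ^ N ∣ taylor 1 φ := by
  constructor
  · rintro rfl; simp
  · intro hd
    by_contra hne
    refine (h hne).not_ge ((le_rootMultiplicity_iff hne).2 ?_)
    have := map_dvd (taylorAlgHom (-1 : ℝ)) hd
    simpa [taylor_taylor, sub_eq_add_neg] using this

theorem X_pow_dvd_taylor_iff {k m : ℕ} (N : ℕ) (f : Fin m → SparseRep) (α : Fin k → Fin m → ℕ) :
    X ^ N ∣ taylor 1 (∑ i, ∏ j, (f j).toPoly ^ α i j) ↔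
      X ^ N ∣ ∑ i, ∏ j, (f j).taylorTrunc N ^ α i j := by
  have hj : ∀ j, Ideal.Quotient.mk (Ideal.span {X ^ N}) (taylor 1 (f j).toPoly) =
      Ideal.Quotient.mk (Ideal.span {X ^ N}) ((f j).taylorTrunc N) := fun j =>
    Ideal.Quotient.eq.2 (Ideal.mem_span_singleton.2 (X_pow_dvd_taylor_sub_taylorTrunc N (f j)))
  have ht : taylor 1 (∑ i, ∏ j, (f j).toPoly ^ α i j) =
      ∑ i, ∏ j, taylor 1 (f j).toPoly ^ α i j := by
    change taylorAlgHom 1 _ = ∑ i, ∏ j, taylorAlgHom 1 (f j).toPoly ^ α i j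
    simp only [map_sum, map_prod, map_pow]
  rw [ht, ← Ideal.mem_span_singleton, ← Ideal.mem_span_singleton, ← Ideal.Quotient.eq_zero_iff_mem,
    ← Ideal.Quotient.eq_zero_iff_mem]
  simp only [map_sum, map_prod, map_pow, hj]

/-! ### Integer fractions -/

/-- An unreduced fraction of integers. -/
structure IntFrac : Type where
  num : ℤ
  den : ℤ

/-- The measure uses the maximum of the two bit lengths.  Unlike their sum, it grows additively
under addition and under a Horner step. -/
instance : Coded IntFrac where
  enc a := .pair (.num a.num) (.num a.den)
  meas a := 1 + 2 * max (Val.num a.num).size (Val.num a.den).size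
  size_le a := by simp only [Val.size]; omega

namespace IntFrac

def mul (a b : IntFrac) : IntFrac := ⟨a.num * b.num, a.den * b.den⟩

def add (a b : IntFrac) : IntFrac := ⟨a.num * b.den + b.num * a.den, a.den * b.den⟩

/-- The Horner step `1 + b * a`, for the accumulated value `a` and the factor `b`. -/
def horner (a b : IntFrac) : IntFrac := ⟨b.den * a.den + b.num * a.num, b.den * a.den⟩

/-- The fraction has a nonzero denominator and the value `x`. -/
def Represents (a : IntFrac) (x : ℝ) : Prop := a.den ≠ 0 ∧ (a.num : ℝ) = x * a.den

theorem Represents.mul {a b : IntFrac} {x y : ℝ} (ha : a.Represents x) (hb : b.Represents y) :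
    (a.mul b).Represents (x * y) := by
  refine ⟨mul_ne_zero ha.1 hb.1, ?_⟩
  simp only [IntFrac.mul, Int.cast_mul, ha.2, hb.2]; ring

theorem Represents.add {a b : IntFrac} {x y : ℝ} (ha : a.Represents x) (hb : b.Represents y) :
    (a.add b).Represents (x + y) := by
  refine ⟨mul_ne_zero ha.1 hb.1, ?_⟩
  simp only [IntFrac.add, Int.cast_mul, Int.cast_add, ha.2, hb.2]; ring

theorem Represents.horner {a b : IntFrac} {x y : ℝ} (ha : a.Represents x) (hb : b.Represents y) :
    (a.horner b).Represents (1 + y * x) := by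
  refine ⟨mul_ne_zero hb.1 ha.1, ?_⟩
  simp only [IntFrac.horner, Int.cast_mul, Int.cast_add, ha.2, hb.2]; ring

theorem represents_zero : Represents ⟨0, 1⟩ 0 := by simp [Represents]

theorem represents_one : Represents ⟨1, 1⟩ 1 := by simp [Represents]

def pow (a : IntFrac) (n : ℕ) : IntFrac := ⟨a.num ^ n, a.den ^ n⟩

theorem Represents.pow {a : IntFrac} {x : ℝ} (ha : a.Represents x) (n : ℕ) :
    (a.pow n).Represents (x ^ n) := by
  refine ⟨pow_ne_zero n ha.1, ?_⟩
  simp only [IntFrac.pow, Int.cast_pow, ha.2, mul_pow]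

theorem represents_foldr_add {n : ℕ} {a : Fin n → IntFrac} {x : Fin n → ℝ}
    (h : ∀ i, (a i).Represents (x i)) :
    ((List.ofFn a).foldr add ⟨0, 1⟩).Represents (∑ i, x i) := by
  induction n with
  | zero => simpa using represents_zero
  | succ n ih =>
    rw [List.ofFn_succ, List.foldr_cons, Fin.sum_univ_succ]
    exact (h 0).add (ih fun i => h i.succ)

theorem represents_foldr_mul {n : ℕ} {a : Fin n → IntFrac} {x : Fin n → ℝ}
    (h : ∀ i, (a i).Represents (x i)) :
    ((List.ofFn a).foldr mul ⟨1, 1⟩).Represents (∏ i, x i) := by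
  induction n with
  | zero => simpa using represents_one
  | succ n ih =>
    rw [List.ofFn_succ, List.foldr_cons, Fin.prod_univ_succ]
    exact (h 0).mul (ih fun i => h i.succ)

end IntFrac

namespace PolyTime

variable {α : Type} [Coded α]

theorem fracNum {f : α → IntFrac} (hf : PolyTime f) : PolyTime fun a => (f a).num := by
  have : PolyTime IntFrac.num := of_prim .fst X (fun _ => rfl) fun a => by
    simp only [meas, eval_X]; omega
  exact this.comp hf

theorem fracDen {f : α → IntFrac} (hf : PolyTime f) : PolyTime fun a => (f a).den := by
  have : PolyTime IntFrac.den := of_prim .snd X (fun _ => rfl) fun a => by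
    simp only [meas, eval_X]; omega
  exact this.comp hf

theorem fracMk {f g : α → ℤ} (hf : PolyTime f) (hg : PolyTime g) :
    PolyTime fun a => IntFrac.mk (f a) (g a) := by
  have : PolyTime fun x : ℤ × ℤ => IntFrac.mk x.1 x.2 :=
    of_prim .id (1 + X + X) (fun _ => rfl) fun x => by
      simp only [meas, eval_add, eval_one, eval_X]; omega
  exact this.comp (hf.pair hg)

theorem fracMul {f g : α → IntFrac} (hf : PolyTime f) (hg : PolyTime g) :
    PolyTime fun a => (f a).mul (g a) :=
  (hf.fracNum.intMul hg.fracNum).fracMk (hf.fracDen.intMul hg.fracDen)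

theorem fracAdd {f g : α → IntFrac} (hf : PolyTime f) (hg : PolyTime g) :
    PolyTime fun a => (f a).add (g a) :=
  ((hf.fracNum.intMul hg.fracDen).intAdd (hg.fracNum.intMul hf.fracDen)).fracMk
    (hf.fracDen.intMul hg.fracDen)

theorem fracHorner {f g : α → IntFrac} (hf : PolyTime f) (hg : PolyTime g) :
    PolyTime fun a => (f a).horner (g a) :=
  ((hg.fracDen.intMul hf.fracDen).intAdd (hg.fracNum.intMul hf.fracNum)).fracMk
    (hg.fracDen.intMul hf.fracDen)

theorem fracPow {f : α → IntFrac} {n : α → ℕ} (hf : PolyTime f) (hn : PolyTime n) :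
    PolyTime fun a => (f a).pow (n a) :=
  (hf.fracNum.intPow hn).fracMk (hf.fracDen.intPow hn)

theorem meas_fracAdd_le (a b : IntFrac) : meas (a.add b) ≤ meas a + 1 * meas b := by
  have h1 := size_natAbs_mul a.num b.den
  have h2 := size_natAbs_mul b.num a.den
  have h3 := size_natAbs_mul a.den b.den
  have h4 := size_natAbs_add (a.num * b.den) (b.num * a.den)
  simp only [meas, IntFrac.add, Val.size]
  omega

theorem meas_fracHorner_le (a b : IntFrac) : meas (a.horner b) ≤ meas a + 1 * meas b := by
  have h1 := size_natAbs_mul b.den a.den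
  have h2 := size_natAbs_mul b.num a.num
  have h4 := size_natAbs_add (b.den * a.den) (b.num * a.num)
  simp only [meas, IntFrac.horner, Val.size]
  omega

end PolyTime

/-! ### The identity test -/

/-- A term of a sparse representation, with its exponent in binary and measured by its bit length.
There is no code for rational numbers alone, so this does not compete with the code for pairs. -/
instance : Coded (ℚ × ℕ) where
  enc s := .pair (.pair (.num s.1.num) (.num (s.1.den : ℤ))) (.num (s.2 : ℤ))
  meas s := (Val.pair (.pair (.num s.1.num) (.num (s.1.den : ℤ))) (.num (s.2 : ℤ))).size
  size_le _ := le_rfl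

namespace PolyTime

variable {α : Type} [Coded α]

theorem term {f : α → ℚ × ℕ} (hf : PolyTime f) :
    PolyTime fun a => (((f a).1.num, ((f a).1.den : ℤ)), ((f a).2 : ℤ)) := by
  have : PolyTime fun s : ℚ × ℕ => ((s.1.num, (s.1.den : ℤ)), (s.2 : ℤ)) :=
    of_prim .id X (fun _ => rfl) fun s => by simp only [eval_X]; exact le_rfl
  exact this.comp hf

theorem termHeight {f : α → ℚ × ℕ} (hf : PolyTime f) : PolyTime fun a => (termHeight (f a) : ℤ) := by
  have hn := hf.term.fst.fst
  have := (const (2 : ℤ)).intMul ((((hn.intMul hn).intAdd (const 1)).intMul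
    hf.term.fst.snd).intMul (hf.term.snd.intAdd (const 1)))
  refine (funext fun a => ?_ : (fun a => (_root_.termHeight (f a) : ℤ)) = _) ▸ this
  simp only [_root_.termHeight]
  push_cast
  rw [sq_abs, sq]

end PolyTime

/-- The value of `binomTrunc N e` at `1 / B`, by Horner's rule for the series with the ratios
`(e - r + 1) / (r * B)` of consecutive terms, from `r = N` down to `r = 1`. -/
def binomFrac (N : ℕ) (B : ℤ) (e : ℤ) : IntFrac :=
  Nat.rec ⟨0, 1⟩ (fun i a => a.horner ⟨e - (N - i) + 1, (N - i) * B⟩) N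

theorem represents_binomFrac (N : ℕ) {B : ℤ} (hB : B ≠ 0) (e : ℕ) :
    (binomFrac N B e).Represents ((binomTrunc N e).eval (B : ℝ)⁻¹) := by
  have hB' : (B : ℝ) ≠ 0 := by exact_mod_cast hB
  let c : ℕ → ℝ := fun r => e.choose r * (B : ℝ)⁻¹ ^ r
  -- after `i` rounds the accumulated value is the tail of the series from degree `N - i` on,
  -- divided by its first term; that term may be zero, hence the multiplied form
  have key : ∀ i ≤ N, ∃ v : ℝ, IntFrac.Represents
      (Nat.rec ⟨0, 1⟩ (fun i a => a.horner ⟨e - (N - i) + 1, (N - i) * B⟩) i : IntFrac) v ∧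
      c (N - i) * v = ∑ r ∈ Finset.Ico (N - i) N, c r := by
    intro i
    induction i with
    | zero => exact fun _ => ⟨0, IntFrac.represents_zero, by simp⟩
    | succ i ih =>
      intro hi
      obtain ⟨v, hv, hs⟩ := ih (by omega)
      obtain ⟨M, rfl⟩ : ∃ M, N = M + 1 + i := ⟨N - (i + 1), by omega⟩
      have e1 : M + 1 + i - i = M + 1 := by omega
      have e2 : M + 1 + i - (i + 1) = M := by omega
      have hM : ((M : ℝ) + 1) ≠ 0 := by positivity
      refine ⟨1 + ((e - M : ℝ) / ((M + 1) * B)) * v, hv.horner ⟨?_, ?_⟩, ?_⟩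
      · push_cast
        rw [add_sub_cancel_right]
        exact mul_ne_zero (by positivity) hB
      · push_cast
        field_simp
        ring
      · rw [e1] at hs
        rw [e2, Finset.sum_eq_sum_Ico_succ_bot (by omega), ← hs]
        -- for `e < M` both sides are zero, although `e - M` is negative
        have hch : ((e.choose (M + 1) : ℕ) : ℝ) * (M + 1) = e.choose M * (e - M) := by
          have := Nat.choose_succ_right_eq e M
          rcases le_or_gt M e with h | h
          · rw [← Nat.cast_sub h]; exact_mod_cast this
          · simp [Nat.choose_eq_zero_of_lt h, Nat.choose_eq_zero_of_lt (Nat.lt_succ_of_lt h)]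
        have hch' : ((e.choose (M + 1) : ℕ) : ℝ) = e.choose M * (e - M) / (M + 1) := by
          rw [← hch]; field_simp
        simp only [c, hch', pow_succ]
        field_simp
  obtain ⟨v, hv, hs⟩ := key N le_rfl
  simp only [Nat.sub_self, c, Nat.choose_zero_right, pow_zero, Nat.cast_one, one_mul] at hs
  rw [hs] at hv
  simpa [binomTrunc, eval_finsetSum, binomFrac] using hv

/-- The value at `1 / B` of the truncated Taylor expansion at `1` of a sparse polynomial. -/
def evalFrac (N : ℕ) (B : ℤ) (l : SparseRep) : IntFrac :=
  l.foldl (fun a s => a.add (IntFrac.mul ⟨s.1.num, s.1.den⟩ (binomFrac N B s.2))) ⟨0, 1⟩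

theorem represents_evalFrac (N : ℕ) {B : ℤ} (hB : B ≠ 0) (l : SparseRep) :
    (evalFrac N B l).Represents ((l.taylorTrunc N).eval (B : ℝ)⁻¹) := by
  have key : ∀ (l : SparseRep) (a : IntFrac) (x : ℝ), a.Represents x →
      IntFrac.Represents (List.foldl
        (fun a s => a.add (IntFrac.mul ⟨s.1.num, s.1.den⟩ (binomFrac N B s.2))) a l)
        (x + (l.taylorTrunc N).eval (B : ℝ)⁻¹) := by
    intro l
    induction l with
    | nil => intro a x h; simpa [SparseRep.taylorTrunc] using h
    | cons s l ih =>
      intro a x h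
      have hs : IntFrac.Represents ⟨s.1.num, s.1.den⟩ (s.1 : ℝ) :=
        ⟨by simp, by exact_mod_cast (Rat.mul_den_eq_num s.1).symm⟩
      have := ih _ _ (h.add (hs.mul (represents_binomFrac N hB s.2)))
      simpa [SparseRep.taylorTrunc, add_assoc] using this
  simpa [evalFrac] using key l _ _ IntFrac.represents_zero

/-- The inputs of the identity test; their code is `encodeInput`. -/
abbrev Input (k m : ℕ) : Type := (Fin m → SparseRep) × (Fin k → Fin m → ℕ)

namespace Input

variable {k m : ℕ}

/-- The total number of terms, which bounds the sparsity of each of the polynomials. -/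
def numTerms (z : Input k m) : ℕ := ∑ j, (z.1 j).length

/-- The sum of all exponents `α i j`. -/
def expSum (z : Input k m) : ℕ := ∑ i, ∑ j, z.2 i j

/-- A strict upper bound for the order at `1` of a nonzero sum of products. -/
def order (z : Input k m) : ℕ := z.numTerms ^ (m * 2 ^ k) + z.expSum * z.numTerms + k + 1

/-- The product of the heights of all terms. -/
def height (z : Input k m) : ℕ := ∏ j, ((z.1 j).map termHeight).prod

/-- Twice the height bound of the sum of products of truncated Taylor expansions. -/
def scale (z : Input k m) : ℕ := 2 ^ (k + 1) * z.height ^ (z.order * z.expSum)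

/-- The sum of products of truncated Taylor expansions, evaluated at `1 / scale ^ 2`. -/
def value (z : Input k m) : IntFrac :=
  (List.ofFn fun i => (List.ofFn fun j =>
    (evalFrac z.order (z.scale ^ 2) (z.1 j)).pow (z.2 i j)).foldr .mul ⟨1, 1⟩).foldr .add ⟨0, 1⟩

/-- The identity test: is the value at `1 / scale ^ 2` below the gap? -/
def test (z : Input k m) : Bool :=
  decide (z.value.num ^ 2 * (z.scale : ℤ) ^ (4 * z.order) < z.value.den ^ 2 * (z.scale : ℤ) ^ 2)

theorem heightLE (f : Fin m → SparseRep) (α : Fin k → Fin m → ℕ) {N : ℕ} (hN : 0 < N) :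
    HeightLE (∑ i, ∏ j, (f j).taylorTrunc N ^ α i j)
      (2 ^ k * height (f, α) ^ (N * expSum (f, α))) := by
  have hpos : ∀ j, 1 ≤ ((f j).map termHeight).prod := fun j =>
    List.one_le_prod_of_one_le (by
      simp only [List.mem_map, forall_exists_index, and_imp]
      rintro _ s _ rfl
      exact one_le_termHeight s)
  have hle : ∀ j, ((f j).map termHeight).prod ≤ height (f, α) := fun j =>
    Finset.single_le_prod' (f := fun j => ((f j).map termHeight).prod) (fun j _ => hpos j)
      (Finset.mem_univ j)
  refine (HeightLE.sum fun i => HeightLE.prod fun j =>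
    ((heightLE_taylorTrunc (f j) hN).mono (Nat.pow_le_pow_left (hle j) N)).pow (α i j)).mono
      (le_of_eq ?_)
  simp only [← pow_mul, Finset.prod_mul_distrib, Finset.prod_const, Finset.card_univ,
    Fintype.card_fin, Finset.prod_pow_eq_pow_sum, ← Finset.mul_sum, expSum]

theorem test_eq_true_iff (f : Fin m → SparseRep) (α : Fin k → Fin m → ℕ)
    (hf : ∀ j, (f j).toPoly ≠ 0) :
    test (f, α) = true ↔ ∑ i, ∏ j, (f j).toPoly ^ α i j = 0 := by
  set z : Input k m := (f, α) with hz
  have hN : 0 < z.order := Nat.succ_pos _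
  have hh : 0 < z.height :=
    Finset.prod_pos fun j _ => List.prod_pos (by
      simp only [List.mem_map, forall_exists_index, and_imp]
      rintro _ s _ rfl
      exact one_le_termHeight s)
  have hC : z.scale ≠ 0 := by
    have : 0 < z.scale := by unfold scale; positivity
    omega
  have hB : ((z.scale : ℤ) ^ 2) ≠ 0 := pow_ne_zero 2 (by exact_mod_cast hC)
  have hsupp : ∀ j, (f j).toPoly.support.card ≤ z.numTerms := by
    intro j
    have : ∀ l : SparseRep, l.toPoly.support.card ≤ l.length := by
      intro l
      induction l with
      | nil => simp [SparseRep.toPoly]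
      | cons s l ih =>
        simp only [SparseRep.toPoly, List.map_cons, List.sum_cons, List.length_cons] at *
        have h1 := Finset.card_le_card
          (support_add (p := monomial s.2 (s.1 : ℝ))
            (q := (l.map fun s => monomial s.2 (s.1 : ℝ)).sum))
        have h2 := Finset.card_union_le (monomial s.2 (s.1 : ℝ)).support
          (l.map fun s => monomial s.2 (s.1 : ℝ)).sum.support
        have h3 := Finset.card_le_card (support_monomial_subset s.2 (s.1 : ℝ))
        rw [Finset.card_singleton] at h3
        omega
    exact (this (f j)).trans
      (Finset.single_le_sum (f := fun j => (f j).length) (fun _ _ => Nat.zero_le _)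
        (Finset.mem_univ j))
  have hA : ∀ i, ∑ j, α i j ≤ z.expSum := fun i =>
    Finset.single_le_sum (f := fun i => ∑ j, α i j) (fun _ _ => Nat.zero_le _) (Finset.mem_univ i)
  have hval : z.value.Represents
      ((∑ i, ∏ j, (f j).taylorTrunc z.order ^ α i j).eval ((z.scale : ℝ) ^ 2)⁻¹) := by
    have := IntFrac.represents_foldr_add fun i => IntFrac.represents_foldr_mul fun j =>
      (represents_evalFrac z.order hB (f j)).pow (α i j)
    simpa [eval_finsetSum, eval_prod, value] using this
  have hscale : 2 * ((2 ^ k * z.height ^ (z.order * z.expSum) : ℕ) : ℝ) ≤ z.scale := by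
    unfold scale
    push_cast
    rw [pow_succ 2 k]
    exact le_of_eq (by ring)
  rw [eq_zero_iff_X_pow_dvd_taylor fun hne => Nat.lt_succ_of_le
      (rootMultiplicity_sum_prod_pow_le _ hf hsupp α hA hne)]
  change _ ↔ X ^ z.order ∣ _
  rw [X_pow_dvd_taylor_iff, X_pow_dvd_iff_eval_small (heightLE f α hN) hN hscale]
  obtain ⟨hd, hv⟩ := hval
  have hd' : (0 : ℝ) < (z.value.den : ℝ) ^ 2 := by
    have : (z.value.den : ℝ) ≠ 0 := by exact_mod_cast hd
    positivity
  rw [test, decide_eq_true_iff, ← Int.cast_lt (R := ℝ)]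
  push_cast
  rw [hv, mul_pow, mul_right_comm, mul_comm _ ((z.scale : ℝ) ^ 2), mul_lt_mul_iff_left₀ hd']

end Input

namespace PolyTime

variable {k m : ℕ}

theorem input_terms (j : Fin m) : PolyTime fun z : Input k m => z.1 j :=
  (apply j).comp fst'

theorem input_exponent (i : Fin k) (j : Fin m) : PolyTime fun z : Input k m => z.2 i j :=
  (apply j).comp ((apply i).comp snd')

theorem numTerms : PolyTime (Input.numTerms (k := k) (m := m)) :=
  natSum fun j => (input_terms j).length

theorem expSum : PolyTime (Input.expSum (k := k) (m := m)) :=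
  natSum fun i => natSum fun j => input_exponent i j

theorem order : PolyTime (Input.order (k := k) (m := m)) :=
  (((numTerms.natPow _).natAdd (expSum.natMul numTerms)).natAdd (const k)).natAdd (const 1)

theorem height : PolyTime fun z : Input k m => (z.height : ℤ) := by
  have h : PolyTime fun l : SparseRep =>
      l.foldl (fun s b => s * (_root_.termHeight b : ℤ)) (1 : ℤ) :=
    foldl (op := fun s b : ℤ => s * b) (x := fun _ b => (_root_.termHeight b : ℤ))
      (fst'.intMul snd') 1 (fun s b => by
        have := size_natAbs_mul s b
        simp only [meas, Val.size]; omega) snd'.termHeight id (const 1)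
  have key : ∀ (l : SparseRep) (n : ℤ), l.foldl (fun s b => s * (_root_.termHeight b : ℤ)) n =
      n * ((l.map _root_.termHeight).prod : ℕ) := by
    intro l
    induction l with
    | nil => simp
    | cons s l ih =>
      intro n
      rw [List.foldl_cons, ih, List.map_cons, List.prod_cons]
      push_cast; ring
  simp only [key, one_mul] at h
  have := intProd fun j => h.comp (input_terms (k := k) (m := m) j)
  refine (funext fun z => ?_ : (fun z : Input k m => (z.height : ℤ)) = _) ▸ this
  simp only [Input.height]
  push_cast
  rfl

theorem scale : PolyTime fun z : Input k m => (z.scale : ℤ) := by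
  simpa only [Input.scale, Nat.cast_mul, Nat.cast_pow, Nat.cast_ofNat] using
    (const ((2 : ℤ) ^ (k + 1))).intMul (height.intPow (order.natMul expSum))

theorem binomFrac : PolyTime fun x : ℕ × ℤ × ℤ => _root_.binomFrac x.1 x.2.1 x.2.2 := by
  have hr : PolyTime fun z : (ℕ × ℤ × ℤ) × ℕ => (z.1.1 : ℤ) - z.2 :=
    fst'.fst.natCast.intSub snd'.natCast
  exact natRec (op := IntFrac.horner)
    (x := fun (x : ℕ × ℤ × ℤ) (i : ℕ) => ⟨x.2.2 - (x.1 - i) + 1, (x.1 - i) * x.2.1⟩)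
    (fst'.fracHorner snd') 1 meas_fracHorner_le
    (((fst'.snd.snd.intSub hr).intAdd (const 1)).fracMk (hr.intMul fst'.snd.fst)) fst' (const _)

theorem evalFrac : PolyTime fun x : ℕ × ℤ × SparseRep => _root_.evalFrac x.1 x.2.1 x.2.2 :=
  foldl (op := IntFrac.add) (x := fun (x : ℕ × ℤ × SparseRep) (s : ℚ × ℕ) =>
      IntFrac.mul ⟨s.1.num, s.1.den⟩ (_root_.binomFrac x.1 x.2.1 s.2))
    (fst'.fracAdd snd') 1 meas_fracAdd_le
    ((snd'.term.fst.fst.fracMk snd'.term.fst.snd).fracMul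
      (binomFrac.comp (fst'.fst.pair (fst'.snd.fst.pair snd'.term.snd)))) snd'.snd (const _)

theorem value : PolyTime (Input.value (k := k) (m := m)) :=
  foldr_ofFn (fst'.fracAdd snd') _ fun i => foldr_ofFn (fst'.fracMul snd') _ fun j =>
    (evalFrac.comp (order.pair ((scale.intPow (const 2)).pair (input_terms j)))).fracPow
      (input_exponent i j)

theorem test : PolyTime (Input.test (k := k) (m := m)) :=
  ((value.fracNum.intPow (const 2)).intMul (scale.intPow ((const 4).natMul order))).intLt
    ((value.fracDen.intPow (const 2)).intMul (scale.intPow (const 2)))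

end PolyTime

/-! ### The decision procedure -/

/-- The measure of an input is linear in the parameter of the running time, for fixed `k` and `m`. -/
theorem meas_input_le {k m : ℕ} (f : Fin m → SparseRep) (α : Fin k → Fin m → ℕ) :
    meas (α := Input k m) (f, α) ≤
      (3 + 2 * m + 2 * k + 2 * (k * m)) + 7 * (∑ j, (f j).bitSize + ∑ i, ∑ j, α i j) := by
  have h1 : ∀ l : SparseRep, meas (α := SparseRep) l ≤ 1 + 7 * l.bitSize := by
    intro l
    induction l with
    | nil => simp [meas]
    | cons s l ih =>
      simp only [meas, SparseRep.bitSize, List.map_cons, List.sum_cons, Val.size,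
        Int.natAbs_natCast] at *
      omega
  have h2 : meas (α := Fin m → SparseRep) f ≤ 1 + (m * 2 + 7 * ∑ j, (f j).bitSize) := by
    simp only [meas]
    refine Nat.add_le_add_left ((Finset.sum_le_sum (g := fun j => 2 + 7 * (f j).bitSize)
      fun j _ => ?_).trans (le_of_eq ?_)) 1
    · have := h1 (f j)
      simp only [meas] at this
      omega
    · simp [Finset.sum_add_distrib, Finset.mul_sum]
  have h3 : meas α = 1 + (k * (2 + m * 2) + ∑ i, ∑ j, α i j) := by
    simp only [meas]
    simp [Finset.sum_add_distrib]
    ring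
  change 1 + meas (α := Fin m → SparseRep) f + meas α ≤ _
  rw [h3]
  refine (Nat.add_le_add_right (Nat.add_le_add_left h2 1) _).trans ?_
  have : k * (2 + m * 2) = 2 * k + 2 * (k * m) := by ring
  omega

theorem theorem4 (k m : ℕ) :
    ∃ (P : BitCost.Prog) (p : Polynomial ℕ),
      ∀ (t : ℕ) (f : Fin m → SparseRep) (α : Fin k → Fin m → ℕ),
        (∀ j, (f j).toPoly ≠ 0 ∧ IsSparse t (f j).toPoly) →
        ∃ (T : ℕ) (b : Bool),
          BitCost.Runs P (encodeInput f α) (BitCost.Val.ofBool b) T ∧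
          T ≤ p.eval (t + ∑ j, (f j).bitSize + ∑ i, ∑ j, α i j) ∧
          (b = true ↔ ∑ i, ∏ j, (f j).toPoly ^ α i j = 0) := by
  obtain ⟨P, p, h⟩ := PolyTime.test (k := k) (m := m)
  refine ⟨P, p.comp (C (3 + 2 * m + 2 * k + 2 * (k * m)) + 7 * X), fun t f α hf => ?_⟩
  obtain ⟨T, hr, hT⟩ := h (f, α)
  refine ⟨T, _, hr, ?_, Input.test_eq_true_iff f α fun j => (hf j).1⟩
  have h1 := Nat.polynomial_eval_mono p ((meas_input_le f α).trans
    (show _ ≤ (3 + 2 * m + 2 * k + 2 * (k * m)) +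
      7 * (t + ∑ j, (f j).bitSize + ∑ i, ∑ j, α i j) by omega))
  simp only [eval_comp, eval_add, eval_mul, eval_C, eval_X, eval_ofNat] at *
  omega
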